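/- Let $S^1=\mathbb R/\mathbb Z$ and let $\mathrm{PAff}_+(S^1)$ be the group of orientation-preserving homeomorphisms $g$ of $S^1$ for which there is a finite set $D\subset S^1$ such that $g$ has the form $x\mapsto ax+b$ with $a>0$ on each connected component of $S^1\setminus D$. Let $\mathbf{Br}_g$ be the finite set of points where $g$ is not differentiable, and $\mathrm{supp}(g)$ the closure of $\{x: g(x)\neq x\}$. Let $G\le \mathrm{PAff}_+(S^1)$ be a countable subgroup whose action on $S^1$ is minimal (all orbits are dense), proximal (for every proper closed interval $I\subsetneq S^1$ and $\varepsilon>0$ there is $g\in G$ with $\mathrm{diam}(g(I))<\varepsilon$) and topologically nonfree (some $g\in G\setminus\{e\}$ has a fixed-point set with nonempty interior). Let $\mu$ be a probability measure on $G$ whose support generates $G$ as a semigroup, with $\sum_{g\in G}\mu(g)\,|\mathbf{Br}_g|<\infty$. Put $\mathbf{Br}=\bigcup_{g\in G}\mathbf{Br}_g$, which is $G$-invariant. For $g\in G$ and $x\in\mathbf{Br}$ put $\mathcal C_g(x)=\log\big((g^{-1})'(x^+)\big)-\log\big((g^{-1})'(x^-)\big)$, where $x^+$ and $x^-$ denote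 right and left derivatives, and let $G$ act on $\mathbb R^{\mathbf{Br}}$ by $(g\cdot\mathcal C)(x)=\mathcal C_g(x)+\mathcal C(g^{-1}x)$. Let $w_n=g_1\cdots g_n$ ($w_0=e$) be the random walk with independent $\mu$-distributed increments $g_i$. Then, almost surely, $\mathcal C_{w_n}$ converges pointwise on $\mathbf{Br}$ to some $\mathcal C_\infty\in\mathbb R^{\mathbf{Br}}$; let the probability measure $\tilde\nu$ on $\mathbb R^{\mathbf{Br}}$ be the distribution of $\mathcal C_\infty$ (so that $(\mathbb R^{\mathbf{Br}},\tilde\nu)$ is the breakpoint boundary). Moreover there are functions $f_n\colon G\to[0,1]$ and elements $a_n\in G$ ($n\in\mathbb N$) such that 1. each $f_n$ is $\mu$-harmonic, that is, $f_n(g)=\sum_{h\in G}f_n(gh)\mu(h)$ for all $g\in G$; 2. each $f_n$ comes from the breakpoint boundary: there is a measurable $F_n\colon\mathbb R^{\mathbf{Br}}\to[0,1]$ with $f_n(g)=\int F_n(g\cdot\mathcal C)\,d\tilde\nu(\mathcal C)$ for all $g\in G$; 3. $f_n(e)>1/2$ for every $n$; 4. $\mathrm{diam}(\mathrm{supp}(a_n))\to0$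 and $f_n(a_n)\to0$ as $n\to\infty$. -/

import Mathlib

open MeasureTheory Filter Topology Set
open scoped ENNReal

noncomputable section

namespace BreakpointBoundary

/-- The group `Homeo(S¹)` of homeomorphisms of `S¹ = ℝ/ℤ`, with composition as product. -/
abbrev CircleHomeo : Type := UnitAddCircle ≃ₜ UnitAddCircle

/-! ### Piecewise affine homeomorphisms and breakpoints -/

/-- `g` preserves the orientation: it lifts to an increasing continuous map of `ℝ`. -/
def OrientationPreserving (g : CircleHomeo) : Prop :=
  ∃ F : ℝ → ℝ, Continuous F ∧ StrictMono F ∧ ∀ u : ℝ, g (u : UnitAddCircle) = (F u : UnitAddCircle)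

/-- `g ∈ PAff₊(S¹)`: there is a finite `D ⊆ S¹` such that on every arc of `S¹ ∖ D` (the image of an
open interval of `ℝ`) the map `g` is of the form `x ↦ a x + b` with `a > 0`. -/
def IsPAff (g : CircleHomeo) : Prop :=
  OrientationPreserving g ∧
  ∃ D : Set UnitAddCircle, D.Finite ∧
    ∀ s t : ℝ, (∀ u ∈ Ioo s t, (u : UnitAddCircle) ∉ D) →
      ∃ a b : ℝ, 0 < a ∧ ∀ u ∈ Ioo s t, g (u : UnitAddCircle) = ((a * u + b : ℝ) : UnitAddCircle)

/-- The representative in `[-1/2, 1/2)` of a point of `ℝ/ℤ`. -/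
def rep (y : UnitAddCircle) : ℝ := (AddCircle.equivIco (1 : ℝ) (-(1 / 2)) y : ℝ)

/-- The map `g` in the charts of `S¹` centred at `x` and at `g x`: near `0` it is the local lift
of `t ↦ g (x + t) - g x` that vanishes at `t = 0`. -/
def localLift (g : CircleHomeo) (x : UnitAddCircle) (t : ℝ) : ℝ :=
  rep (g (x + (t : UnitAddCircle)) - g x)

/-- The right derivative `g'(x⁺)`. -/
def rightDeriv (g : CircleHomeo) (x : UnitAddCircle) : ℝ :=
  derivWithin (localLift g x) (Ici 0) 0

/-- The left derivative `g'(x⁻)`. -/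
def leftDeriv (g : CircleHomeo) (x : UnitAddCircle) : ℝ :=
  derivWithin (localLift g x) (Iic 0) 0

/-- The set `Br_g` of breakpoints of `g`: the points at which `g` is not differentiable. -/
def breakpoints (g : CircleHomeo) : Set UnitAddCircle :=
  {x | ¬ DifferentiableAt ℝ (localLift g x) 0}

/-- The set `Br` of all breakpoints of elements of `G`. -/
def Br (G : Subgroup CircleHomeo) : Set UnitAddCircle :=
  ⋃ g ∈ G, breakpoints g

/-- `supp(g)`, the closure of the set of points moved by `g`. -/
def supp (g : CircleHomeo) : Set UnitAddCircle := closure {x | g x ≠ x}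

/-! ### Dynamical properties of the action on the circle -/

/-- All orbits are dense. -/
def IsMinimalAction (G : Subgroup CircleHomeo) : Prop :=
  ∀ x : UnitAddCircle, Dense {y | ∃ g ∈ G, g x = y}

/-- Every proper closed interval (closed connected proper subset) has images under `G` of
arbitrarily small diameter. -/
def IsProximalAction (G : Subgroup CircleHomeo) : Prop :=
  ∀ I : Set UnitAddCircle, IsClosed I → IsConnected I → I ≠ univ →
    ∀ ε > 0, ∃ g ∈ G, Metric.diam (g '' I) < ε

/-- Some nontrivial element of `G` has a set of fixed points with nonempty interior. -/
def IsTopologicallyNonfree (G : Subgroup CircleHomeo) : Prop :=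
  ∃ g ∈ G, g ≠ 1 ∧ (interior {x | g x = x}).Nonempty

/-! ### Random walks and harmonic functions -/

/-- The semigroup generated by the support of `μ` is the whole group. -/
def Nondegenerate {G : Type*} [Group G] (μ : PMF G) : Prop :=
  Subsemigroup.closure μ.support = ⊤

/-- `f` is `μ`-harmonic: `f(g) = ∑ₕ f(gh) μ(h)` for all `g`. -/
def IsHarmonic {G : Type*} [Group G] (μ : PMF G) (f : G → ℝ) : Prop :=
  ∀ g : G, HasSum (fun h : G => f (g * h) * (μ h).toReal) (f g)

/-- A (countable) group of homeomorphisms of the circle carries the discrete σ-algebra. -/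
instance instMeasurableSpaceSubgroup (G : Subgroup CircleHomeo) : MeasurableSpace G := ⊤

instance instDiscreteMeasurableSpaceSubgroup (G : Subgroup CircleHomeo) :
    DiscreteMeasurableSpace G := ⟨fun _ => trivial⟩

/-- The trajectory `(e, g₁, g₁g₂, g₁g₂g₃, …)` with increments `g₁, g₂, g₃, …`. -/
def trajectory {G : Type*} [Group G] (g : ℕ → G) : ℕ → G
  | 0 => 1
  | n + 1 => trajectory g n * g n

/-- The law on the space `G^ℕ` of trajectories of the right `μ`-random walk started at `e`. -/
def pathMeasure {G : Subgroup CircleHomeo} (μ : PMF G) : Measure (ℕ → G) :=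
  (Measure.infinitePi fun _ : ℕ => μ.toMeasure).map trajectory

/-! ### Configurations on the breakpoints -/

lemma coe_rep (y : UnitAddCircle) : ((rep y : ℝ) : UnitAddCircle) = y :=
  AddCircle.coe_equivIco

lemma rep_coe {t : ℝ} (h1 : -(1 / 2) ≤ t) (h2 : t < 1 / 2) : rep (t : UnitAddCircle) = t := by
  unfold rep
  exact AddCircle.equivIco_coe_of_mem ⟨h1, by linarith⟩

lemma localLift_zero (g : CircleHomeo) (x : UnitAddCircle) : localLift g x 0 = 0 := by
  have h := rep_coe (t := 0) (by norm_num) (by norm_num)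
  simp only [localLift, AddCircle.coe_zero, add_zero, sub_self]
  simpa using h

lemma continuousAt_localLift (g : CircleHomeo) (x : UnitAddCircle) :
    ContinuousAt (localLift g x) 0 := by
  have hne : (0 : UnitAddCircle) ≠ ((-(1 / 2) : ℝ) : UnitAddCircle) := by
    intro h
    have h1 := rep_coe (t := 0) (by norm_num) (by norm_num)
    have h2 := rep_coe (t := -(1 / 2)) (by norm_num) (by norm_num)
    rw [← h] at h2
    rw [AddCircle.coe_zero, h2] at h1
    norm_num at h1
  have hr : ContinuousAt rep (0 : UnitAddCircle) :=
    continuousAt_subtype_val.comp (AddCircle.continuousAt_equivIco (1 : ℝ) (-(1 / 2)) hne)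
  have hc : Continuous fun t : ℝ => g (x + (t : UnitAddCircle)) - g x :=
    (g.continuous.comp (continuous_const.add (AddCircle.continuous_mk' (1 : ℝ)))).sub
      continuous_const
  have h0 : g (x + ((0 : ℝ) : UnitAddCircle)) - g x = 0 := by simp
  have := ContinuousAt.comp (f := fun t : ℝ => g (x + (t : UnitAddCircle)) - g x) (x := 0)
    (g := rep) (by rw [h0]; exact hr) hc.continuousAt
  exact this

/-- The chain rule before differentiation. -/
lemma localLift_mul (h g : CircleHomeo) (x : UnitAddCircle) (t : ℝ) :
    localLift (h * g) x t = localLift h (g x) (localLift g x t) := by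
  simp only [localLift, coe_rep, Homeomorph.mul_apply, add_sub_cancel]

lemma exists_slope {g : CircleHomeo} (hg : IsPAff g) (x : UnitAddCircle) :
    ∃ a > 0, HasDerivWithinAt (localLift g x) a (Ioi 0) 0 := by
  obtain ⟨-, D, hD, haff⟩ := hg
  obtain ⟨v, rfl⟩ := QuotientAddGroup.mk_surjective x
  have hev : ∀ᶠ u : ℝ in 𝓝 v, (u : UnitAddCircle) ∉ D \ {(v : UnitAddCircle)} := by
    have hcl : IsOpen (D \ {(v : UnitAddCircle)})ᶜ := (hD.subset sdiff_subset).isClosed.isOpen_compl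
    exact (AddCircle.continuous_mk' (1 : ℝ)).continuousAt.eventually_mem
      (hcl.mem_nhds (by simp))
  obtain ⟨ε, hε, hball⟩ := Metric.eventually_nhds_iff.1 hev
  set δ := min ε (1 / 4) with hδ
  have hδ0 : 0 < δ := lt_min hε (by norm_num)
  have hδε : δ ≤ ε := min_le_left _ _
  have hδ4 : δ ≤ 1 / 4 := min_le_right _ _
  obtain ⟨a, b, ha, hab⟩ := haff v (v + δ) (by
    intro u hu huD
    refine hball (y := u) ?_ ⟨huD, ?_⟩
    · rw [Real.dist_eq, abs_of_pos (by linarith [hu.1])]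
      linarith [hu.2]
    · intro he
      have h1 : ((u - v : ℝ) : UnitAddCircle) = ((0 : ℝ) : UnitAddCircle) := by
        rw [AddCircle.coe_sub, (he : (u : UnitAddCircle) = v), sub_self, AddCircle.coe_zero]
      have h2 := congrArg rep h1
      rw [rep_coe (by linarith [hu.1]) (by linarith [hu.2]),
        rep_coe (by norm_num) (by norm_num)] at h2
      linarith [hu.1])
  have hv : g (v : UnitAddCircle) = ((a * v + b : ℝ) : UnitAddCircle) := by
    have c1 : Tendsto (fun u : ℝ => g (u : UnitAddCircle)) (𝓝[>] v) (𝓝 (g (v : UnitAddCircle))) :=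
      ((g.continuous.comp (AddCircle.continuous_mk' (1 : ℝ))).tendsto v).mono_left
        nhdsWithin_le_nhds
    have c2 : Tendsto (fun u : ℝ => ((a * u + b : ℝ) : UnitAddCircle)) (𝓝[>] v)
        (𝓝 ((a * v + b : ℝ) : UnitAddCircle)) :=
      (((AddCircle.continuous_mk' (1 : ℝ)).comp (by fun_prop : Continuous fun u : ℝ => a * u + b)
        ).tendsto v).mono_left nhdsWithin_le_nhds
    refine tendsto_nhds_unique (c1.congr' ?_) c2
    filter_upwards [Ioo_mem_nhdsGT (by linarith : v < v + δ)] with u hu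
    exact hab u hu
  refine ⟨a, ha, ?_⟩
  have hlin : HasDerivWithinAt (fun t : ℝ => a * t) a (Ioi 0) 0 := by
    simpa using ((hasDerivAt_id (0 : ℝ)).const_mul a).hasDerivWithinAt
  refine hlin.congr_of_eventuallyEq ?_ (by simp [localLift_zero])
  have hm : 0 < min δ (1 / (4 * a)) := lt_min hδ0 (by positivity)
  filter_upwards [Ioo_mem_nhdsGT hm] with t ht
  have ht1 : t < δ := ht.2.trans_le (min_le_left _ _)
  have ht2 : t < 1 / (4 * a) := ht.2.trans_le (min_le_right _ _)
  have ht3 : a * t < 1 / 4 := by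
    rw [lt_div_iff₀ (by positivity)] at ht2
    linarith
  have hpos : 0 < a * t := mul_pos ha ht.1
  have hgt : g ((v : UnitAddCircle) + (t : UnitAddCircle)) =
      ((a * (v + t) + b : ℝ) : UnitAddCircle) := by
    rw [← AddCircle.coe_add]
    exact hab (v + t) ⟨by linarith [ht.1], by linarith⟩
  rw [localLift, hgt, hv, ← AddCircle.coe_sub,
    show a * (v + t) + b - (a * v + b) = a * t by ring]
  exact rep_coe (by linarith) (by linarith)

/-- The set of breakpoints of `G` is invariant under `G`. -/
lemma map_mem_Br {G : Subgroup CircleHomeo} (hG : ∀ g ∈ G, IsPAff g) (g : G)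
    {x : UnitAddCircle} (hx : x ∈ Br G) : (g : CircleHomeo) x ∈ Br G := by
  obtain ⟨g, hg⟩ := g
  change g x ∈ Br G
  simp only [Br, mem_iUnion, exists_prop] at hx ⊢
  obtain ⟨h, hh, hhx⟩ := hx
  by_contra hcon
  push Not at hcon
  have d1 : DifferentiableAt ℝ (localLift g⁻¹ (g x)) 0 := by
    simpa [breakpoints] using hcon g⁻¹ (G.inv_mem hg)
  have d2 : DifferentiableAt ℝ (localLift (h * g⁻¹) (g x)) 0 := by
    simpa [breakpoints] using hcon (h * g⁻¹) (G.mul_mem hh (G.inv_mem hg))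
  have hinv : g⁻¹ (g x) = x := by
    rw [← Homeomorph.mul_apply, inv_mul_cancel]; rfl
  obtain ⟨a, ha, hda⟩ := exists_slope (hG g⁻¹ (G.inv_mem hg)) (g x)
  have hne : deriv (localLift g⁻¹ (g x)) 0 ≠ 0 := by
    have e1 := d1.hasDerivAt.hasDerivWithinAt (s := Ioi 0)
    rw [(uniqueDiffWithinAt_Ioi (0 : ℝ)).eq_deriv _ e1 hda]
    exact ha.ne'
  have d3 : HasDerivAt (localLift g x) (deriv (localLift g⁻¹ (g x)) 0)⁻¹ 0 := by
    refine HasDerivAt.of_local_left_inverse (f := localLift g⁻¹ (g x))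
      (continuousAt_localLift g x) ?_ hne ?_
    · rw [localLift_zero]
      exact d1.hasDerivAt
    · filter_upwards [Ioo_mem_nhds (by norm_num : (-(1 / 2) : ℝ) < 0)
        (by norm_num : (0 : ℝ) < 1 / 2)] with t ht
      rw [← localLift_mul, inv_mul_cancel]
      have : localLift 1 x t = rep (t : UnitAddCircle) := by simp [localLift]
      rw [this, rep_coe ht.1.le ht.2]
  apply hhx
  have hcomp : localLift h x = localLift (h * g⁻¹) (g x) ∘ localLift g x := by
    funext t
    rw [Function.comp_apply, ← localLift_mul, inv_mul_cancel_right]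
  rw [hcomp]
  refine DifferentiableAt.comp (0 : ℝ) ?_ d3.differentiableAt
  rw [localLift_zero]
  exact d2

/-- The configuration `C_g : Br → ℝ`,
`C_g(x) = log (g⁻¹)'(x⁺) - log (g⁻¹)'(x⁻)`. -/
def config {G : Subgroup CircleHomeo} (g : G) (x : Br G) : ℝ :=
  Real.log (rightDeriv (g⁻¹ : G) x) - Real.log (leftDeriv (g⁻¹ : G) x)

/-- The action `g · C = C_g + S_g C` of `G` on `ℝ^Br`, where `(S_g C)(x) = C(g⁻¹ x)`. -/
def act {G : Subgroup CircleHomeo} (hG : ∀ g ∈ G, IsPAff g) (g : G) (C : Br G → ℝ) :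
    Br G → ℝ :=
  fun x => config g x + C ⟨((g⁻¹ : G) : CircleHomeo) x, map_mem_Br hG g⁻¹ x.2⟩

/-- The limit configuration `C_∞(w) = lim_n C_{w_n}` (pointwise limit) of a trajectory `w`. -/
def limitConfig {G : Subgroup CircleHomeo} (w : ℕ → G) : Br G → ℝ :=
  fun x => limUnder atTop fun n => config (w n) x

/-- The measure `ν̃` of the breakpoint boundary `(ℝ^Br, ν̃)`: the distribution of `C_∞`. -/
def breakpointMeasure {G : Subgroup CircleHomeo} (μ : PMF G) : Measure (Br G → ℝ) :=
  (pathMeasure μ).map limitConfig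

end BreakpointBoundary

end

noncomputable section

namespace BreakpointBoundary

/-! ### Germs of piecewise affine homeomorphisms -/

/-! Convergence. By the cocycle identity `config_mul`, step `n` of the walk changes the
configuration at `x` only if `w_n⁻¹ x` is a breakpoint of the inverse of the next increment. The
expected number of such changes is `∑ₙ Pⁿb(x)`, where `P` is the Markov operator of `x ↦ h⁻¹ x` and
`b(x)` is the probability that `x` is a breakpoint of the inverse of a `μ`-random element. The
moment condition gives `∑ₓ b(x) < ∞`, so `b` lies in `ℓ²` of the circle viewed as a discrete set. On
that space `P` has a spectral gap: minimality and proximality carry each of two half circles into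
any of three disjoint open sets, so no vector is almost invariant (`exists_finset_norm_le`,
`exists_spectral_gap`). Hence the potential of `b` is bounded (`exists_potential_le`), and by
Borel–Cantelli the configuration at `x` is almost surely eventually constant.

Harmonic functions. Nonfreeness and proximality give `a ∈ G` of small support that fixes a point `q`
with `config a q ≠ 0` (`exists_config_ne_zero`). The powers of `a` translate the coordinate `C q` by
multiples of this number. The event `|C q| ≤ R` has probability above `1/2` for large `R`, while its
translates by `a ^ k` have probability tending to `0`; powers do not enlarge the support.
Stationarity of the limit law (`hasSum_integral_act`) makes the Poisson transform of this event
harmonic. -/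

lemma localLift_eventually_eq {g : CircleHomeo} {a b s t v : ℝ} (hst : s < t)
    (hg : ∀ u ∈ Ioo s t, g (u : UnitAddCircle) = ((a * u + b : ℝ) : UnitAddCircle))
    (hv : v ∈ Icc s t) :
    ∀ᶠ τ in 𝓝 (0 : ℝ), v + τ ∈ Icc s t → localLift g (v : UnitAddCircle) τ = a * τ := by
  -- Continuity extends the affine formula to the endpoints, so the lemma also yields one-sided
  -- germs.
  have hext : EqOn (fun u : ℝ => g (u : UnitAddCircle))
      (fun u : ℝ => ((a * u + b : ℝ) : UnitAddCircle)) (Icc s t) := by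
    rw [← closure_Ioo hst.ne]
    refine EqOn.closure hg (g.continuous.comp (AddCircle.continuous_mk' (1 : ℝ))) ?_
    exact (AddCircle.continuous_mk' (1 : ℝ)).comp (by fun_prop : Continuous fun u : ℝ => a * u + b)
  have hsmall : ∀ᶠ τ in 𝓝 (0 : ℝ), a * τ ∈ Ioo (-(1 / 2) : ℝ) (1 / 2) := by
    have hc : ContinuousAt (fun τ : ℝ => a * τ) 0 := by fun_prop
    exact hc.eventually_mem (by simpa using Ioo_mem_nhds (by norm_num) (by norm_num))
  filter_upwards [hsmall] with τ hτ hmem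
  have h1 := hext hmem
  have h2 := hext hv
  simp only at h1 h2
  rw [localLift, ← AddCircle.coe_add, h1, h2, ← AddCircle.coe_sub,
    show a * (v + τ) + b - (a * v + b) = a * τ by ring]
  exact rep_coe hτ.1.le hτ.2

lemma coe_eventually_ne (v : ℝ) :
    ∀ᶠ u : ℝ in 𝓝[≠] v, (u : UnitAddCircle) ≠ (v : UnitAddCircle) := by
  rw [eventually_nhdsWithin_iff]
  filter_upwards [Ioo_mem_nhds (by linarith : v - 1 / 2 < v) (by linarith : v < v + 1 / 2)]
    with u hu hne he
  have h1 : ((u - v : ℝ) : UnitAddCircle) = ((0 : ℝ) : UnitAddCircle) := by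
    rw [AddCircle.coe_sub, he, sub_self, AddCircle.coe_zero]
  have h2 := congrArg rep h1
  rw [rep_coe (by linarith [hu.1]) (by linarith [hu.2]),
    rep_coe (by norm_num) (by norm_num)] at h2
  exact hne (by simpa [sub_eq_zero] using h2)

lemma coe_eventually_notMem {D : Set UnitAddCircle} (hD : D.Finite) (v : ℝ) :
    ∀ᶠ u : ℝ in 𝓝 v, (u : UnitAddCircle) ∉ D \ {(v : UnitAddCircle)} := by
  have hcl : IsOpen (D \ {(v : UnitAddCircle)})ᶜ := (hD.subset sdiff_subset).isClosed.isOpen_compl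
  exact (AddCircle.continuous_mk' (1 : ℝ)).continuousAt.eventually_mem (hcl.mem_nhds (by simp))

/-- Near every point, `g` is linear in the charts on both sides. -/
lemma exists_germs {g : CircleHomeo} (hg : IsPAff g) (x : UnitAddCircle) :
    ∃ a > 0, ∃ b > 0, (∀ᶠ t in 𝓝[≥] (0 : ℝ), localLift g x t = a * t) ∧
      ∀ᶠ t in 𝓝[≤] (0 : ℝ), localLift g x t = b * t := by
  obtain ⟨-, D, hD, haff⟩ := hg
  obtain ⟨v, rfl⟩ := QuotientAddGroup.mk_surjective x
  have hev : ∀ᶠ u : ℝ in 𝓝[≠] v, (u : UnitAddCircle) ∉ D := by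
    filter_upwards [coe_eventually_ne v, (coe_eventually_notMem hD v).filter_mono
      nhdsWithin_le_nhds] with u h1 h2 h3
    exact h2 ⟨h3, h1⟩
  rw [eventually_nhdsWithin_iff, Metric.eventually_nhds_iff] at hev
  obtain ⟨δ, hδ, hball⟩ := hev
  have key : ∀ s t : ℝ, s < t → v - δ ≤ s → t ≤ v + δ → v ∉ Ioo s t → v ∈ Icc s t →
      ∃ a > 0, ∀ᶠ τ in 𝓝 (0 : ℝ), v + τ ∈ Icc s t → localLift g (v : UnitAddCircle) τ = a * τ := by
    intro s t hst h1 h2 h3 h4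
    obtain ⟨a, b, ha, hab⟩ := haff s t (by
      intro u hu
      refine hball ?_ ?_
      · rw [Real.dist_eq, abs_lt]; constructor <;> linarith [hu.1, hu.2]
      · rintro rfl; exact h3 hu)
    exact ⟨a, ha, localLift_eventually_eq hst hab h4⟩
  obtain ⟨a, ha, h1⟩ := key v (v + δ) (by linarith) (by linarith) le_rfl (by simp)
    ⟨le_rfl, by linarith⟩
  obtain ⟨b, hb, h2⟩ := key (v - δ) v (by linarith) le_rfl (by linarith) (by simp)
    ⟨by linarith, le_rfl⟩
  refine ⟨a, ha, b, hb, ?_, ?_⟩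
  · rw [eventually_nhdsWithin_iff]
    filter_upwards [h1, Ioo_mem_nhds (neg_lt_zero.2 hδ) hδ] with t ht hts ht0
    exact ht ⟨by simpa using ht0, by linarith [hts.2]⟩
  · rw [eventually_nhdsWithin_iff]
    filter_upwards [h2, Ioo_mem_nhds (neg_lt_zero.2 hδ) hδ] with t ht hts ht0
    exact ht ⟨by linarith [hts.1], by simpa using ht0⟩

lemma breakpoints_finite {g : CircleHomeo} (hg : IsPAff g) : (breakpoints g).Finite := by
  obtain ⟨-, D, hD, haff⟩ := hg
  refine hD.subset fun x hx => ?_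
  by_contra hxD
  apply hx
  obtain ⟨v, rfl⟩ := QuotientAddGroup.mk_surjective x
  have hev : ∀ᶠ u : ℝ in 𝓝 v, (u : UnitAddCircle) ∉ D := by
    filter_upwards [coe_eventually_notMem hD v] with u hu huD
    refine hu ⟨huD, fun h => hxD ?_⟩
    rwa [← (h : (u : UnitAddCircle) = v)]
  obtain ⟨δ, hδ, hball⟩ := Metric.eventually_nhds_iff.1 hev
  obtain ⟨a, b, ha, hab⟩ := haff (v - δ) (v + δ) (by
    intro u hu
    refine hball ?_
    rw [Real.dist_eq, abs_lt]; constructor <;> linarith [hu.1, hu.2])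
  have h := localLift_eventually_eq (v := v) (by linarith) hab ⟨by linarith, by linarith⟩
  have hlin : HasDerivAt (fun t : ℝ => a * t) a 0 := by
    simpa using (hasDerivAt_id (0 : ℝ)).const_mul a
  refine (hlin.congr_of_eventuallyEq ?_).differentiableAt
  filter_upwards [h, Ioo_mem_nhds (neg_lt_zero.2 hδ) hδ] with t ht hts
  exact ht ⟨by linarith [hts.1], by linarith [hts.2]⟩

lemma rightDeriv_eq {g : CircleHomeo} {x : UnitAddCircle} {a : ℝ}
    (h : ∀ᶠ t in 𝓝[≥] (0 : ℝ), localLift g x t = a * t) : rightDeriv g x = a := by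
  have hlin : HasDerivWithinAt (fun t : ℝ => a * t) a (Ici 0) 0 := by
    simpa using ((hasDerivAt_id (0 : ℝ)).const_mul a).hasDerivWithinAt
  exact (hlin.congr_of_eventuallyEq h (by simp [localLift_zero])).derivWithin
    (uniqueDiffWithinAt_Ici 0)

lemma leftDeriv_eq {g : CircleHomeo} {x : UnitAddCircle} {a : ℝ}
    (h : ∀ᶠ t in 𝓝[≤] (0 : ℝ), localLift g x t = a * t) : leftDeriv g x = a := by
  have hlin : HasDerivWithinAt (fun t : ℝ => a * t) a (Iic 0) 0 := by
    simpa using ((hasDerivAt_id (0 : ℝ)).const_mul a).hasDerivWithinAt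
  exact (hlin.congr_of_eventuallyEq h (by simp [localLift_zero])).derivWithin
    (uniqueDiffWithinAt_Iic 0)

lemma localLift_eventually_right {g : CircleHomeo} (hg : IsPAff g) (x : UnitAddCircle) :
    ∀ᶠ t in 𝓝[≥] (0 : ℝ), localLift g x t = rightDeriv g x * t := by
  obtain ⟨a, -, b, -, h, -⟩ := exists_germs hg x
  rwa [rightDeriv_eq h]

lemma localLift_eventually_left {g : CircleHomeo} (hg : IsPAff g) (x : UnitAddCircle) :
    ∀ᶠ t in 𝓝[≤] (0 : ℝ), localLift g x t = leftDeriv g x * t := by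
  obtain ⟨a, -, b, -, -, h⟩ := exists_germs hg x
  rwa [leftDeriv_eq h]

lemma rightDeriv_pos {g : CircleHomeo} (hg : IsPAff g) (x : UnitAddCircle) :
    0 < rightDeriv g x := by
  obtain ⟨a, ha, b, -, h, -⟩ := exists_germs hg x
  rwa [rightDeriv_eq h]

lemma leftDeriv_pos {g : CircleHomeo} (hg : IsPAff g) (x : UnitAddCircle) :
    0 < leftDeriv g x := by
  obtain ⟨a, -, b, hb, -, h⟩ := exists_germs hg x
  rwa [leftDeriv_eq h]

lemma rightDeriv_mul {h g : CircleHomeo} (hh : IsPAff h) (hg : IsPAff g) (x : UnitAddCircle) :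
    rightDeriv (h * g) x = rightDeriv h (g x) * rightDeriv g x := by
  apply rightDeriv_eq
  have hg0 := localLift_eventually_right hg x
  have hlim : Tendsto (fun t : ℝ => rightDeriv g x * t) (𝓝[≥] 0) (𝓝[≥] 0) := by
    refine tendsto_nhdsWithin_iff.2 ⟨?_, ?_⟩
    · have : Tendsto (fun t : ℝ => rightDeriv g x * t) (𝓝 0) (𝓝 (rightDeriv g x * 0)) :=
        (continuous_const.mul continuous_id).tendsto 0
      rw [mul_zero] at this
      exact this.mono_left nhdsWithin_le_nhds
    · filter_upwards [self_mem_nhdsWithin] with t ht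
      exact mul_nonneg (rightDeriv_pos hg x).le ht
  filter_upwards [hg0, hlim.eventually (localLift_eventually_right hh (g x))] with t h1 h2
  rw [localLift_mul, h1, h2, mul_assoc]

lemma leftDeriv_mul {h g : CircleHomeo} (hh : IsPAff h) (hg : IsPAff g) (x : UnitAddCircle) :
    leftDeriv (h * g) x = leftDeriv h (g x) * leftDeriv g x := by
  apply leftDeriv_eq
  have hg0 := localLift_eventually_left hg x
  have hlim : Tendsto (fun t : ℝ => leftDeriv g x * t) (𝓝[≤] 0) (𝓝[≤] 0) := by
    refine tendsto_nhdsWithin_iff.2 ⟨?_, ?_⟩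
    · have : Tendsto (fun t : ℝ => leftDeriv g x * t) (𝓝 0) (𝓝 (leftDeriv g x * 0)) :=
        (continuous_const.mul continuous_id).tendsto 0
      rw [mul_zero] at this
      exact this.mono_left nhdsWithin_le_nhds
    · filter_upwards [self_mem_nhdsWithin] with t ht
      exact mul_nonpos_of_nonneg_of_nonpos (leftDeriv_pos hg x).le ht
  filter_upwards [hg0, hlim.eventually (localLift_eventually_left hh (g x))] with t h1 h2
  rw [localLift_mul, h1, h2, mul_assoc]

lemma localLift_one_eventually (x : UnitAddCircle) :
    ∀ᶠ t in 𝓝 (0 : ℝ), localLift 1 x t = 1 * t := by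
  filter_upwards [Ioo_mem_nhds (by norm_num : (-(1 / 2) : ℝ) < 0)
    (by norm_num : (0 : ℝ) < 1 / 2)] with t ht
  have : localLift 1 x t = rep (t : UnitAddCircle) := by simp [localLift]
  rw [this, rep_coe ht.1.le ht.2, one_mul]

lemma rightDeriv_one (x : UnitAddCircle) : rightDeriv 1 x = 1 :=
  rightDeriv_eq ((localLift_one_eventually x).filter_mono nhdsWithin_le_nhds)

lemma leftDeriv_one (x : UnitAddCircle) : leftDeriv 1 x = 1 :=
  leftDeriv_eq ((localLift_one_eventually x).filter_mono nhdsWithin_le_nhds)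

/-- Both one-sided germs are linear, so differentiability is just the matching of the two slopes. -/
lemma mem_breakpoints_iff {g : CircleHomeo} (hg : IsPAff g) (x : UnitAddCircle) :
    x ∈ breakpoints g ↔ rightDeriv g x ≠ leftDeriv g x := by
  rw [breakpoints, mem_ofPred_eq, not_iff_not]
  constructor
  · intro h
    rw [rightDeriv, leftDeriv, h.hasDerivAt.hasDerivWithinAt.derivWithin (uniqueDiffWithinAt_Ici 0),
      h.hasDerivAt.hasDerivWithinAt.derivWithin (uniqueDiffWithinAt_Iic 0)]
  · intro h
    have hr := localLift_eventually_right hg x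
    have hl := localLift_eventually_left hg x
    rw [← h] at hl
    have hev := eventually_sup.2 ⟨hl, hr⟩
    rw [nhdsLE_sup_nhdsGE] at hev
    have hlin : HasDerivAt (fun t : ℝ => rightDeriv g x * t) (rightDeriv g x) 0 := by
      simpa using (hasDerivAt_id (0 : ℝ)).const_mul (rightDeriv g x)
    exact (hlin.congr_of_eventuallyEq hev).differentiableAt

/-! ### The configuration cocycle and the action on the breakpoints -/

section Group

variable {G : Subgroup CircleHomeo}

lemma inv_apply_apply (g : CircleHomeo) (x : UnitAddCircle) : g⁻¹ (g x) = x := by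
  rw [← Homeomorph.mul_apply, inv_mul_cancel]; rfl

lemma apply_inv_apply (g : CircleHomeo) (x : UnitAddCircle) : g (g⁻¹ x) = x := by
  rw [← Homeomorph.mul_apply, mul_inv_cancel]; rfl

/-- Needed because configurations see the slopes of `g⁻¹`, while the moment condition counts
breakpoints of `g`. The slopes of `g⁻¹` at `x` and of `g` at `g⁻¹ x` are reciprocal on each side. -/
lemma breakpoints_inv (hG : ∀ g ∈ G, IsPAff g) {g : CircleHomeo} (hg : g ∈ G) :
    breakpoints g⁻¹ ⊆ g '' breakpoints g := by
  intro x hx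
  refine ⟨g⁻¹ x, ?_, apply_inv_apply g x⟩
  rw [mem_breakpoints_iff (hG _ hg)]
  rw [mem_breakpoints_iff (hG _ (G.inv_mem hg))] at hx
  intro h
  apply hx
  have h1 := rightDeriv_mul (hG _ hg) (hG _ (G.inv_mem hg)) x
  have h2 := leftDeriv_mul (hG _ hg) (hG _ (G.inv_mem hg)) x
  rw [mul_inv_cancel, rightDeriv_one, h] at h1
  rw [mul_inv_cancel, leftDeriv_one] at h2
  exact mul_left_cancel₀ (leftDeriv_pos (hG _ hg) _).ne' (h1.symm.trans h2)

lemma encard_breakpoints_inv_le (hG : ∀ g ∈ G, IsPAff g) {g : CircleHomeo} (hg : g ∈ G) :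
    (breakpoints g⁻¹).encard ≤ (breakpoints g).encard :=
  (encard_le_encard (breakpoints_inv hG hg)).trans (encard_image_le _ _)

lemma Br_countable [Countable G] (hG : ∀ g ∈ G, IsPAff g) : (Br G).Countable := by
  have : Br G = ⋃ g : G, breakpoints (g : CircleHomeo) := by
    ext x
    simp [Br]
  rw [this]
  exact countable_iUnion fun g => (breakpoints_finite (hG _ g.2)).countable

/-- The inverse of `g ∈ G` acting on the set of breakpoints of `G`. -/
abbrev invOnBr (hG : ∀ g ∈ G, IsPAff g) (g : G) (x : Br G) : Br G :=
  ⟨((g⁻¹ : G) : CircleHomeo) x, map_mem_Br hG g⁻¹ x.2⟩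

lemma config_one (x : Br G) : config (1 : G) x = 0 := by
  simp [config, rightDeriv_one, leftDeriv_one]

/-- Chain rule for `(gh)⁻¹ = h⁻¹g⁻¹`. With `h` the next increment of the walk, the second summand is
the whole change of the configuration. -/
lemma config_mul (hG : ∀ g ∈ G, IsPAff g) (g h : G) (x : Br G) :
    config (g * h) x = config g x + config h (invOnBr hG g x) := by
  have hg := hG _ (g⁻¹).2
  have hh := hG _ (h⁻¹).2
  simp only [config, mul_inv_rev, Subgroup.coe_mul]
  rw [rightDeriv_mul hh hg, leftDeriv_mul hh hg,
    Real.log_mul (rightDeriv_pos hh _).ne' (rightDeriv_pos hg _).ne',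
    Real.log_mul (leftDeriv_pos hh _).ne' (leftDeriv_pos hg _).ne']
  ring

lemma act_mul (hG : ∀ g ∈ G, IsPAff g) (g h : G) (C : Br G → ℝ) :
    act hG (g * h) C = act hG g (act hG h C) := by
  funext x
  simp only [act]
  rw [config_mul hG g h x, add_assoc]
  congr 3

lemma act_one (hG : ∀ g ∈ G, IsPAff g) (C : Br G → ℝ) : act hG 1 C = C := by
  funext x
  simp [act, config_one]

lemma config_eq_zero_of_notMem (hG : ∀ g ∈ G, IsPAff g) (g : G) (x : Br G)
    (hx : (x : UnitAddCircle) ∉ breakpoints ((g : CircleHomeo)⁻¹)) : config g x = 0 := by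
  rw [mem_breakpoints_iff (hG _ (G.inv_mem g.2)), not_not] at hx
  simp only [config, Subgroup.coe_inv]
  rw [hx, sub_self]

lemma config_pow_of_fixed (hG : ∀ g ∈ G, IsPAff g) (a : G) (q : Br G)
    (hq : (a : CircleHomeo) q = q) (k : ℕ) : config (a ^ k) q = k * config a q := by
  induction k with
  | zero => simp [config_one]
  | succ k ih =>
    have hfix : invOnBr hG a q = q := by
      apply Subtype.ext
      have := inv_apply_apply (a : CircleHomeo) q
      rw [hq] at this
      simpa using this
    rw [pow_succ', config_mul hG, hfix, ih]
    push_cast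
    ring

end Group

/-! ### Dynamics on the circle -/

/-- The image in the circle of the segment `[s, t]`. -/
def arc (s t : ℝ) : Set UnitAddCircle := (fun u : ℝ => (u : UnitAddCircle)) '' Icc s t

lemma isClosed_arc (s t : ℝ) : IsClosed (arc s t) :=
  (isCompact_Icc.image (AddCircle.continuous_mk' (1 : ℝ))).isClosed

lemma isConnected_arc {s t : ℝ} (hst : s ≤ t) : IsConnected (arc s t) :=
  (isConnected_Icc hst).image _ (AddCircle.continuous_mk' (1 : ℝ)).continuousOn

lemma arc_ne_univ {s t : ℝ} (hst : s ≤ t) (h : t < s + 1) : arc s t ≠ univ := by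
  intro huniv
  have hm : (((t + (s + 1)) / 2 : ℝ) : UnitAddCircle) ∈ arc s t := huniv ▸ mem_univ _
  obtain ⟨u, hu, he⟩ := hm
  have := (AddCircle.coe_eq_coe_iff_of_mem_Ico (p := (1 : ℝ)) (a := s)
    ⟨hu.1, by linarith [hu.2]⟩ ⟨by linarith, by linarith⟩).1 he
  linarith [hu.2]

lemma exists_coe_mem_Ico (s : ℝ) (x : UnitAddCircle) :
    ∃ u ∈ Ico s (s + 1), (u : UnitAddCircle) = x :=
  ⟨AddCircle.equivIco (1 : ℝ) s x, (AddCircle.equivIco (1 : ℝ) s x).2, AddCircle.coe_equivIco⟩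

lemma arc_union : arc 0 (1 / 2) ∪ arc (1 / 2) 1 = univ := by
  refine eq_univ_of_forall fun x => ?_
  obtain ⟨u, hu, rfl⟩ := exists_coe_mem_Ico 0 x
  rcases le_total u (1 / 2) with h | h
  · exact Or.inl ⟨u, ⟨hu.1, h⟩, rfl⟩
  · exact Or.inr ⟨u, ⟨h, by linarith [hu.2]⟩, rfl⟩

/-- The action is extremely proximal: proper closed intervals can be moved into any open set. -/
lemma exists_image_subset {G : Subgroup CircleHomeo} (hmin : IsMinimalAction G)
    (hprox : IsProximalAction G) {I U : Set UnitAddCircle} (hI : IsClosed I) (hc : IsConnected I)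
    (hne : I ≠ univ) (hU : IsOpen U) (hUne : U.Nonempty) :
    ∃ g ∈ G, (g : CircleHomeo) '' I ⊆ U := by
  -- By minimality the preimages of `U` cover the compact circle. Once proximality has shrunk `I`
  -- below a Lebesgue number of this cover, a single further element moves it into `U`.
  obtain ⟨δ, hδ, hleb⟩ := lebesgue_number_lemma_of_metric (s := (univ : Set UnitAddCircle))
    (c := fun h : G => (h : CircleHomeo) ⁻¹' U) isCompact_univ
    (fun h => hU.preimage (h : CircleHomeo).continuous) (by
      intro x _
      obtain ⟨y, hyU, h, hh, rfl⟩ := (hmin x).exists_mem_open hU hUne |>.imp fun y hy => hy.symm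
      exact mem_iUnion.2 ⟨⟨h, hh⟩, hyU⟩)
  obtain ⟨g, hg, hdiam⟩ := hprox I hI hc hne δ hδ
  obtain ⟨p, hp⟩ := hc.nonempty
  obtain ⟨h, hh⟩ := hleb (g p) (mem_univ _)
  refine ⟨h * g, G.mul_mem h.2 hg, ?_⟩
  rintro _ ⟨z, hz, rfl⟩
  refine hh (Metric.mem_ball.2 (lt_of_le_of_lt ?_ hdiam))
  exact Metric.dist_le_diam_of_mem
    ((isCompact_univ.isBounded).subset (subset_univ _)) (mem_image_of_mem _ hz)
    (mem_image_of_mem _ hp)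

lemma supp_conj_subset_image {g h : CircleHomeo} : supp (h * g * h⁻¹) ⊆ h '' supp g := by
  have hcl : IsClosed (h '' supp g) := h.isClosedMap _ isClosed_closure
  refine closure_minimal (fun x hx => ?_) hcl
  refine ⟨h⁻¹ x, subset_closure fun hfix => hx ?_, apply_inv_apply h x⟩
  rw [Homeomorph.mul_apply, Homeomorph.mul_apply, hfix, apply_inv_apply]

lemma diam_supp_pow_le (g : CircleHomeo) (k : ℕ) :
    Metric.diam (supp (g ^ k)) ≤ Metric.diam (supp g) := by
  refine Metric.diam_mono (closure_mono fun x hx hfix => hx ?_)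
    ((isCompact_univ.isBounded).subset (subset_univ _))
  induction k with
  | zero => rfl
  | succ k ih =>
    rw [pow_succ, Homeomorph.mul_apply, hfix]
    by_contra hne
    exact hne (ih hne)

lemma exists_fixed_interval {g : CircleHomeo} (hint : (interior {x | g x = x}).Nonempty) :
    ∃ v : ℝ, ∃ δ > 0, ∀ u ∈ Ioo (v - δ) (v + δ), g (u : UnitAddCircle) = u := by
  obtain ⟨x, hx⟩ := hint
  obtain ⟨v, rfl⟩ := QuotientAddGroup.mk_surjective x
  have hev : ∀ᶠ u : ℝ in 𝓝 v, g (u : UnitAddCircle) = u := by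
    filter_upwards [(AddCircle.continuous_mk' (1 : ℝ)).continuousAt.eventually_mem
      (isOpen_interior.mem_nhds hx)] with u hu
    exact interior_subset (s := {x | g x = x}) hu
  obtain ⟨δ, hδ, hball⟩ := Metric.eventually_nhds_iff.1 hev
  refine ⟨v, δ, hδ, fun u hu => hball ?_⟩
  rw [Real.dist_eq, abs_lt]
  constructor <;> linarith [hu.1, hu.2]

/-- The support of a nonfree element misses an open interval, hence lies in a proper closed arc.
Conjugating by an element that contracts this arc shrinks the support. -/
lemma exists_small_supp {G : Subgroup CircleHomeo} (hprox : IsProximalAction G)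
    (hnonfree : IsTopologicallyNonfree G) {ε : ℝ} (hε : 0 < ε) :
    ∃ a ∈ G, a ≠ 1 ∧ (interior {x | a x = x}).Nonempty ∧ Metric.diam (supp a) < ε := by
  obtain ⟨g, hg, hne, hint⟩ := hnonfree
  obtain ⟨v, δ₀, hδ₀, hfix₀⟩ := exists_fixed_interval hint
  obtain ⟨δ, hδ, hδ4, hfix⟩ : ∃ δ > 0, δ ≤ 1 / 4 ∧
      ∀ u ∈ Ioo (v - δ) (v + δ), g (u : UnitAddCircle) = u :=
    ⟨min δ₀ (1 / 4), lt_min hδ₀ (by norm_num), min_le_right _ _, fun u hu => hfix₀ u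
      ⟨by linarith [hu.1, min_le_left δ₀ (1 / 4)], by linarith [hu.2, min_le_left δ₀ (1 / 4)]⟩⟩
  have hsupp : supp g ⊆ arc (v + δ) (v + 1 - δ) := by
    refine closure_minimal (fun x hx => ?_) (isClosed_arc _ _)
    obtain ⟨u, hu, rfl⟩ := exists_coe_mem_Ico v x
    refine ⟨u, ⟨?_, ?_⟩, rfl⟩
    · by_contra hlt
      exact hx (hfix u ⟨by linarith [hu.1], by linarith⟩)
    · by_contra hlt
      apply hx
      have hper : ((u - 1 : ℝ) : UnitAddCircle) = u := by
        rw [AddCircle.coe_sub, AddCircle.coe_period, sub_zero]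
      rw [← hper]
      exact hfix _ ⟨by linarith, by linarith [hu.2]⟩
  obtain ⟨h, hh, hdiam⟩ := hprox _ (isClosed_arc _ _)
    (isConnected_arc (by linarith : v + δ ≤ v + 1 - δ)) (arc_ne_univ (by linarith) (by linarith))
    ε hε
  refine ⟨h * g * h⁻¹, G.mul_mem (G.mul_mem hh hg) (G.inv_mem hh), ?_, ?_, ?_⟩
  · simpa [mul_inv_eq_one] using hne
  · obtain ⟨x, hx⟩ := hint
    refine ⟨h x, mem_interior.2 ⟨h '' interior {x | g x = x}, ?_,
      h.isOpenMap _ isOpen_interior, mem_image_of_mem _ hx⟩⟩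
    rintro _ ⟨y, hy, rfl⟩
    have hy' : g y = y := interior_subset (s := {x | g x = x}) hy
    change (h * g * h⁻¹) (h y) = h y
    rw [Homeomorph.mul_apply, Homeomorph.mul_apply, inv_apply_apply, hy']
  · refine (Metric.diam_mono (supp_conj_subset_image.trans (image_mono hsupp))
      ((isCompact_univ.isBounded).subset (subset_univ _))).trans_lt hdiam

/-- An endpoint of an interval of fixed points is a fixed breakpoint. -/
lemma exists_fixed_breakpoint {g : CircleHomeo} (hg : IsPAff g) (hne : g ≠ 1)
    (hint : (interior {x | g x = x}).Nonempty) : ∃ q ∈ breakpoints g, g q = q := by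
  obtain ⟨v, δ, hδ, hfix⟩ := exists_fixed_interval hint
  have hclosed : IsClosed {u : ℝ | g (u : UnitAddCircle) = u} :=
    isClosed_eq (g.continuous.comp (AddCircle.continuous_mk' (1 : ℝ)))
      (AddCircle.continuous_mk' (1 : ℝ))
  -- The supremum `s` of `T` is the right end of the interval of fixed points starting at `v`, and
  -- `g ≠ 1` forces `s < v + 1`. The left slope at `s` is `1`; a right slope `1` would prolong the
  -- interval beyond `s`.
  set T : Set ℝ := {t | t ≤ v + 1 ∧ ∀ u ∈ Icc v t, g (u : UnitAddCircle) = u} with hT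
  have hTbdd : BddAbove T := ⟨v + 1, fun t ht => ht.1⟩
  have hmemT : min (v + δ / 2) (v + 1) ∈ T := by
    refine ⟨min_le_right _ _, fun u hu => hfix u ⟨by linarith [hu.1], ?_⟩⟩
    linarith [hu.2, min_le_left (v + δ / 2) (v + 1)]
  set s := sSup T with hs
  have hvs : v < s :=
    (lt_min (by linarith) (by linarith : v < v + 1)).trans_le (le_csSup hTbdd hmemT)
  have hs1 : s ≤ v + 1 := csSup_le ⟨_, hmemT⟩ fun t ht => ht.1
  have hIcc : ∀ u ∈ Icc v s, g (u : UnitAddCircle) = u := by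
    have h1 : Ico v s ⊆ {u : ℝ | g (u : UnitAddCircle) = u} := by
      intro u hu
      obtain ⟨t, ht, hut⟩ := exists_lt_of_lt_csSup ⟨_, hmemT⟩ hu.2
      exact ht.2 u ⟨hu.1, hut.le⟩
    have h2 := closure_minimal h1 hclosed
    rw [closure_Ico hvs.ne] at h2
    exact h2
  have hs2 : s < v + 1 := by
    refine lt_of_le_of_ne hs1 fun heq => hne ?_
    ext x
    obtain ⟨u, hu, rfl⟩ := exists_coe_mem_Ico v x
    exact hIcc u ⟨hu.1, by linarith [hu.2]⟩
  have hsfix := hIcc s ⟨hvs.le, le_rfl⟩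
  refine ⟨(s : UnitAddCircle), ?_, hsfix⟩
  rw [mem_breakpoints_iff hg]
  have hleft : leftDeriv g (s : UnitAddCircle) = 1 := by
    apply leftDeriv_eq
    rw [eventually_nhdsWithin_iff]
    filter_upwards [Ioo_mem_nhds (by linarith : v - s < 0) (by norm_num : (0 : ℝ) < 1 / 2),
      Ioo_mem_nhds (by norm_num : (-(1 / 2) : ℝ) < 0) (by norm_num : (0 : ℝ) < 1 / 2)]
      with t ht ht' ht0
    have ht0' : t ≤ 0 := ht0
    rw [localLift, ← AddCircle.coe_add, hIcc (s + t) ⟨by linarith [ht.1], by linarith⟩, hsfix,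
      AddCircle.coe_add, add_sub_cancel_left, rep_coe ht'.1.le ht'.2, one_mul]
  rw [hleft]
  intro hright
  have hr := localLift_eventually_right hg (s : UnitAddCircle)
  rw [hright, eventually_nhdsWithin_iff, Metric.eventually_nhds_iff] at hr
  obtain ⟨η, hη, hr⟩ := hr
  have hT' : min (s + η / 2) (v + 1) ∈ T := by
    refine ⟨min_le_right _ _, fun u hu => ?_⟩
    rcases le_total u s with h | h
    · exact hIcc u ⟨hu.1, h⟩
    · have h1 := hr (y := u - s) (by
        rw [Real.dist_eq, abs_lt]
        constructor <;> linarith [hu.2, min_le_left (s + η / 2) (v + 1)]) (by simpa using h)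
      have h2 := congrArg (fun r : ℝ => (r : UnitAddCircle)) h1
      simp only [localLift, coe_rep, one_mul] at h2
      rw [← AddCircle.coe_add, add_sub_cancel, hsfix, AddCircle.coe_sub, sub_left_inj] at h2
      exact h2
  have := le_csSup hTbdd hT'
  rw [← hs] at this
  exact absurd (lt_min (by linarith) hs2 : s < min (s + η / 2) (v + 1)) (not_lt.2 this)

lemma exists_config_ne_zero {G : Subgroup CircleHomeo} (hG : ∀ g ∈ G, IsPAff g)
    (hprox : IsProximalAction G) (hnonfree : IsTopologicallyNonfree G) {ε : ℝ} (hε : 0 < ε) :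
    ∃ (a : G) (q : Br G), Metric.diam (supp (a : CircleHomeo)) < ε ∧
      (a : CircleHomeo) q = q ∧ config a q ≠ 0 := by
  obtain ⟨a, ha, hne, hint, hdiam⟩ := exists_small_supp hprox hnonfree hε
  have ha' := hG _ (G.inv_mem ha)
  have hfix : {x | a⁻¹ x = x} = {x | a x = x} := by
    ext x
    constructor
    · intro h
      have := apply_inv_apply a x
      rwa [h] at this
    · intro h
      have := inv_apply_apply a x
      rwa [h] at this
  -- The breakpoint is found for `a⁻¹`, whose slopes define `config a`.
  obtain ⟨q, hq, hqfix⟩ := exists_fixed_breakpoint ha' (inv_ne_one.2 hne) (hfix ▸ hint)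
  have hqBr : q ∈ Br G := by
    simp only [Br, mem_iUnion]
    exact ⟨a⁻¹, G.inv_mem ha, hq⟩
  refine ⟨⟨a, ha⟩, ⟨q, hqBr⟩, hdiam, ?_, ?_⟩
  · have := apply_inv_apply a q
    rwa [hqfix] at this
  · rw [mem_breakpoints_iff ha'] at hq
    simp only [config, Subgroup.coe_inv]
    intro h
    exact hq (Real.log_injOn_pos (rightDeriv_pos ha' q) (leftDeriv_pos ha' q) (sub_eq_zero.1 h))

/-! ### The spectral gap of the action on `ℓ²(S¹)` -/

/-- Square summable functions on the circle. -/
abbrev EllTwo : Type := lp (fun _ : UnitAddCircle => ℝ) 2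

lemma memEllTwo {f : UnitAddCircle → ℝ} (hf : Summable fun x => f x ^ 2) :
    Memℓp (E := fun _ : UnitAddCircle => ℝ) f 2 := by
  refine memℓp_gen ?_
  simpa using hf

lemma hasSum_sq (f : EllTwo) : HasSum (fun x => f x ^ 2) (‖f‖ ^ 2) := by
  have := lp.hasSum_norm (p := 2) (by norm_num) f
  simpa using this

lemma norm_le_norm_of_abs_le {f g : EllTwo} (h : ∀ x, |f x| ≤ |g x|) : ‖f‖ ≤ ‖g‖ := by
  refine (pow_le_pow_iff_left₀ (norm_nonneg _) (norm_nonneg _) two_ne_zero).1 ?_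
  exact hasSum_le (fun x => sq_le_sq.2 (h x)) (hasSum_sq f) (hasSum_sq g)

/-- The restriction of `f` to `A`, extended by zero. -/
def restr (A : Set UnitAddCircle) (f : EllTwo) : EllTwo :=
  ⟨A.indicator f, memEllTwo ((hasSum_sq f).summable.of_nonneg_of_le (fun _ => sq_nonneg _) fun x => by
    by_cases hx : x ∈ A <;> simp [hx, sq_nonneg])⟩

lemma restr_apply (A : Set UnitAddCircle) (f : EllTwo) (x : UnitAddCircle) :
    restr A f x = A.indicator f x := rfl

lemma norm_restr_le (A : Set UnitAddCircle) (f : EllTwo) : ‖restr A f‖ ≤ ‖f‖ := by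
  refine norm_le_norm_of_abs_le fun x => ?_
  rw [restr_apply]
  by_cases hx : x ∈ A <;> simp [hx]

lemma restr_sub (A : Set UnitAddCircle) (f g : EllTwo) :
    restr A (f - g) = restr A f - restr A g := by
  ext x
  simp only [lp.coeFn_sub, Pi.sub_apply, restr_apply]
  by_cases hx : x ∈ A <;> simp [hx]

/-- The isometric action of circle homeomorphisms on `ℓ²(S¹)`. -/
def translate (g : CircleHomeo) : EllTwo →ₗᵢ[ℝ] EllTwo where
  toFun f := ⟨fun x => f (g⁻¹ x), memEllTwo
    ((g⁻¹ : CircleHomeo).toEquiv.summable_iff.2 (hasSum_sq f).summable)⟩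
  map_add' _ _ := rfl
  map_smul' _ _ := rfl
  norm_map' f := by
    refine (pow_left_inj₀ (norm_nonneg _) (norm_nonneg _) two_ne_zero).1 ?_
    exact (hasSum_sq _).unique ((g⁻¹ : CircleHomeo).toEquiv.hasSum_iff.2 (hasSum_sq f))

lemma translate_apply (g : CircleHomeo) (f : EllTwo) (x : UnitAddCircle) :
    translate g f x = f (g⁻¹ x) := rfl

lemma translate_mul (g h : CircleHomeo) (f : EllTwo) :
    translate (g * h) f = translate g (translate h f) := by
  ext x
  simp only [translate_apply, mul_inv_rev, Homeomorph.mul_apply]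

/-- Translation by `g` carries the mass of `f` on `I` into `U`, so if `f` is nearly `g`-invariant
then `U` carries nearly as much mass as `I`. -/
lemma norm_restr_le_of_image_subset {g : CircleHomeo} {I U : Set UnitAddCircle} (h : g '' I ⊆ U)
    (f : EllTwo) : ‖restr I f‖ ≤ ‖restr U f‖ + ‖translate g f - f‖ := by
  have h1 : ‖restr I f‖ ≤ ‖restr U (translate g f)‖ := by
    rw [← (translate g).norm_map (restr I f)]
    refine norm_le_norm_of_abs_le fun x => ?_
    rw [translate_apply, restr_apply, restr_apply]
    by_cases hx : g⁻¹ x ∈ I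
    · have hxU : x ∈ U := h ⟨_, hx, apply_inv_apply g x⟩
      rw [indicator_of_mem hx, indicator_of_mem hxU, translate_apply]
    · rw [indicator_of_notMem hx, abs_zero]
      exact abs_nonneg _
  have h2 : restr U (translate g f) = restr U f + restr U (translate g f - f) := by
    rw [restr_sub]; abel
  rw [h2] at h1
  exact h1.trans ((norm_add_le _ _).trans (add_le_add_right (norm_restr_le _ _) _))

/-- The action on the circle has no almost invariant vectors. -/
lemma exists_finset_norm_le {G : Subgroup CircleHomeo} (hmin : IsMinimalAction G)
    (hprox : IsProximalAction G) :
    ∃ S : Finset G, ∀ f : EllTwo, ∃ g ∈ S, ‖f‖ ≤ 20 * ‖translate g f - f‖ := by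
  classical
  have : Infinite UnitAddCircle :=
    (AddCircle.equivIco (1 : ℝ) 0).infinite_iff.2 (Ico_infinite (by norm_num)).to_subtype
  obtain ⟨U, hUinf, hUo, hUd⟩ := exists_seq_infinite_isOpen_pairwise_disjoint UnitAddCircle
  have key : ∀ s t : ℝ, s ≤ t → t < s + 1 → ∀ j, ∃ g : G, (g : CircleHomeo) '' arc s t ⊆ U j := by
    intro s t h1 h2 j
    obtain ⟨g, hg, h⟩ := exists_image_subset hmin hprox (isClosed_arc s t) (isConnected_arc h1)
      (arc_ne_univ h1 h2) (hUo j) (hUinf j).nonempty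
    exact ⟨⟨g, hg⟩, h⟩
  choose g hg using key 0 (1 / 2) (by norm_num) (by norm_num)
  choose h hh using key (1 / 2) 1 (by norm_num) (by norm_num)
  refine ⟨{g 0, g 1, g 2, h 0, h 1, h 2}, fun f => ?_⟩
  by_contra hcon
  push Not at hcon
  have hN : ‖f‖ ^ 2 ≤ ‖restr (arc 0 (1 / 2)) f‖ ^ 2 + ‖restr (arc (1 / 2) 1) f‖ ^ 2 := by
    refine hasSum_le (fun x => ?_) (hasSum_sq f) ((hasSum_sq _).add (hasSum_sq _))
    have hx : x ∈ arc 0 (1 / 2) ∪ arc (1 / 2) 1 := arc_union ▸ mem_univ x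
    rw [restr_apply, restr_apply]
    rcases hx with hx | hx
    · rw [indicator_of_mem hx]
      exact le_add_of_nonneg_right (sq_nonneg _)
    · rw [indicator_of_mem hx]
      exact le_add_of_nonneg_left (sq_nonneg _)
  have hU : ‖restr (U 0) f‖ ^ 2 + ‖restr (U 1) f‖ ^ 2 + ‖restr (U 2) f‖ ^ 2 ≤ ‖f‖ ^ 2 := by
    refine hasSum_le (fun x => ?_)
      (((hasSum_sq (restr (U 0) f)).add (hasSum_sq (restr (U 1) f))).add
        (hasSum_sq (restr (U 2) f))) (hasSum_sq f)
    simp only [restr_apply]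
    have d01 : x ∈ U 0 → x ∉ U 1 := fun hx => disjoint_left.1 (hUd (by norm_num : (0 : ℕ) ≠ 1)) hx
    have d02 : x ∈ U 0 → x ∉ U 2 := fun hx => disjoint_left.1 (hUd (by norm_num : (0 : ℕ) ≠ 2)) hx
    have d12 : x ∈ U 1 → x ∉ U 2 := fun hx => disjoint_left.1 (hUd (by norm_num : (1 : ℕ) ≠ 2)) hx
    by_cases h0 : x ∈ U 0
    · simp [h0, d01 h0, d02 h0]
    · by_cases h1 : x ∈ U 1
      · simp [h0, h1, d12 h1]
      · by_cases h2 : x ∈ U 2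
        · simp [h0, h1, h2]
        · simp [h0, h1, h2, sq_nonneg]
  -- The heavier half circle carries norm at least `‖f‖/√2 ≥ 0.7‖f‖`. If all six displacements were
  -- below `‖f‖/20`, each of the three disjoint sets would carry at least `0.65‖f‖`, and `3 · 0.65²
  -- > 1`. Two sets would not give a contradiction.
  have hbound : ∀ a : ℝ, 0 ≤ a → ‖f‖ ^ 2 ≤ 2 * a ^ 2 →
      (∀ j ∈ ({0, 1, 2} : Finset ℕ), a ≤ ‖restr (U j) f‖ + ‖f‖ / 20) → 0 < ‖f‖ → False := by
    intro a ha h1 h2 hf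
    have ha' : 7 / 10 * ‖f‖ ≤ a := by nlinarith
    have hj : ∀ j ∈ ({0, 1, 2} : Finset ℕ), (65 / 100 * ‖f‖) ^ 2 ≤ ‖restr (U j) f‖ ^ 2 := by
      intro j hj
      refine pow_le_pow_left₀ (by positivity) ?_ 2
      linarith [h2 j hj]
    have := hj 0 (by simp)
    have := hj 1 (by simp)
    have := hj 2 (by simp)
    nlinarith [sq_pos_of_pos hf]
  have hf : 0 < ‖f‖ := by
    have h1 := hcon (g 0) (by simp)
    have h2 := norm_nonneg (translate (g 0 : CircleHomeo) f - f)
    linarith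
  rcases le_total ‖restr (arc 0 (1 / 2)) f‖ ‖restr (arc (1 / 2) 1) f‖ with hle | hle
  · refine hbound ‖restr (arc (1 / 2) 1) f‖ (norm_nonneg _) ?_ (fun j hj => ?_) hf
    · have := pow_le_pow_left₀ (norm_nonneg (restr (arc 0 (1 / 2)) f)) hle 2
      linarith
    · have h1 := norm_restr_le_of_image_subset (hh j) f
      have h2 := hcon (h j) (by
        simp only [Finset.mem_insert, Finset.mem_singleton] at hj
        rcases hj with rfl | rfl | rfl <;> simp)
      linarith
  · refine hbound ‖restr (arc 0 (1 / 2)) f‖ (norm_nonneg _) ?_ (fun j hj => ?_) hf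
    · have := pow_le_pow_left₀ (norm_nonneg (restr (arc (1 / 2) 1) f)) hle 2
      linarith
    · have h1 := norm_restr_le_of_image_subset (hg j) f
      have h2 := hcon (g j) (by
        simp only [Finset.mem_insert, Finset.mem_singleton] at hj
        rcases hj with rfl | rfl | rfl <;> simp)
      linarith

/-! ### Energy, Markov operator and potentials -/

section Average

variable {G : Subgroup CircleHomeo} (μ : PMF G)

lemma hasSum_toReal : HasSum (fun h : G => (μ h).toReal) 1 := by
  have h := ENNReal.hasSum_toReal (f := μ) (by rw [μ.tsum_coe]; exact ENNReal.one_ne_top)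
  rwa [← ENNReal.tsum_toReal_eq (fun a => μ.apply_ne_top a), μ.tsum_coe, ENNReal.toReal_one] at h

/-- Twice the Dirichlet form of the random walk on the circle. -/
def energy (f : EllTwo) : ℝ :=
  ∑' h : G, (μ h).toReal * ‖translate (h : CircleHomeo) f - f‖ ^ 2

lemma summable_energy (f : EllTwo) :
    Summable fun h : G => (μ h).toReal * ‖translate (h : CircleHomeo) f - f‖ ^ 2 := by
  refine ((hasSum_toReal μ).summable.mul_right ((2 * ‖f‖) ^ 2)).of_nonneg_of_le
    (fun h => by positivity) fun h => ?_
  gcongr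
  refine (norm_sub_le _ _).trans ?_
  rw [(translate _).norm_map, two_mul]

lemma energy_nonneg (f : EllTwo) : 0 ≤ energy μ f := tsum_nonneg fun h => by positivity

/-- For `g` in the support of `μ`, one summand of the energy suffices. The triangle inequality
passes to products, and semigroup generation makes inverses unnecessary. -/
lemma exists_displacement_le_energy (hμ : Nondegenerate μ) (g : G) :
    ∃ C > 0, ∀ f : EllTwo, ‖translate (g : CircleHomeo) f - f‖ ^ 2 ≤ C * energy μ f := by
  have hg : g ∈ Subsemigroup.closure μ.support := by rw [hμ]; trivial
  induction hg using Subsemigroup.closure_induction with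
  | mem g hg =>
    have hpos : 0 < (μ g).toReal := ENNReal.toReal_pos ((μ.mem_support_iff g).1 hg)
      (μ.apply_ne_top g)
    refine ⟨(μ g).toReal⁻¹, by positivity, fun f => ?_⟩
    have := (summable_energy μ f).le_tsum g (fun h _ => by positivity)
    rw [inv_mul_eq_div, le_div_iff₀ hpos, mul_comm]
    exact this
  | mul g h _ _ ihg ihh =>
    obtain ⟨C, hC, h1⟩ := ihg
    obtain ⟨C', hC', h2⟩ := ihh
    refine ⟨2 * (C + C'), by positivity, fun f => ?_⟩
    have h3 : ‖translate ((g * h : G) : CircleHomeo) f - f‖ ≤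
        ‖translate (g : CircleHomeo) f - f‖ + ‖translate (h : CircleHomeo) f - f‖ := by
      rw [Subgroup.coe_mul, translate_mul]
      refine (norm_sub_le_norm_sub_add_norm_sub _ (translate (g : CircleHomeo) f) _).trans ?_
      rw [← map_sub, (translate _).norm_map, add_comm]
    have h4 := pow_le_pow_left₀ (norm_nonneg _) h3 2
    nlinarith [h1 f, h2 f, sq_nonneg (‖translate (g : CircleHomeo) f - f‖ -
      ‖translate (h : CircleHomeo) f - f‖)]

lemma exists_spectral_gap (hmin : IsMinimalAction G) (hprox : IsProximalAction G)
    (hμ : Nondegenerate μ) : ∃ δ > 0, ∀ f : EllTwo, δ * ‖f‖ ^ 2 ≤ energy μ f := by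
  obtain ⟨S, hS⟩ := exists_finset_norm_le hmin hprox
  choose C hC hdisp using exists_displacement_le_energy μ hμ
  have hsum : 0 ≤ ∑ g ∈ S, C g := Finset.sum_nonneg fun g _ => (hC g).le
  -- `400 = 20²` squares the constant of `exists_finset_norm_le`; the `+ 1` keeps the denominator
  -- positive.
  refine ⟨(400 * (∑ g ∈ S, C g + 1))⁻¹, by positivity, fun f => ?_⟩
  obtain ⟨g, hg, hf⟩ := hS f
  rw [inv_mul_le_iff₀ (by positivity)]
  have h1 := pow_le_pow_left₀ (norm_nonneg _) hf 2
  have h2 := hdisp g f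
  have h3 : C g ≤ ∑ g ∈ S, C g := Finset.single_le_sum (fun g _ => (hC g).le) hg
  have h4 := mul_le_mul_of_nonneg_right h3 (energy_nonneg μ f)
  nlinarith [energy_nonneg μ f]

/-- The Markov operator of the walk `x ↦ h⁻¹ x` on the circle. -/
def average (f : EllTwo) : EllTwo := ∑' h : G, (μ h).toReal • translate (h : CircleHomeo) f

lemma hasSum_average (f : EllTwo) :
    HasSum (fun h : G => (μ h).toReal • translate (h : CircleHomeo) f) (average μ f) := by
  refine Summable.hasSum (Summable.of_norm ?_)
  refine ((hasSum_toReal μ).summable.mul_right ‖f‖).congr fun h => ?_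
  rw [norm_smul, (translate _).norm_map, Real.norm_of_nonneg ENNReal.toReal_nonneg]

lemma hasSum_average_apply (f : EllTwo) (x : UnitAddCircle) :
    HasSum (fun h : G => (μ h).toReal * f ((h : CircleHomeo)⁻¹ x)) (average μ f x) :=
  (hasSum_average μ f).mapL (lp.evalCLM ℝ (fun _ : UnitAddCircle => ℝ) 2 x)

/-- Polarization for isometries: `2⟨f, hf⟩ = 2‖f‖² - ‖hf - f‖²`, averaged over `h`. No symmetry of
`μ` is involved. -/
lemma inner_average_self (f : EllTwo) :
    inner ℝ f (average μ f) = ‖f‖ ^ 2 - energy μ f / 2 := by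
  have h1 := (hasSum_average μ f).mapL (innerSL ℝ f)
  have h2 := ((hasSum_toReal μ).mul_right (‖f‖ ^ 2)).sub ((summable_energy μ f).hasSum.div_const 2)
  rw [one_mul] at h2
  refine h1.unique (h2.congr_fun ?_)
  intro h
  have h3 := norm_sub_sq_real (translate (h : CircleHomeo) f) f
  rw [(translate _).norm_map, real_inner_comm] at h3
  simp only [map_smul, innerSL_apply_apply, smul_eq_mul]
  rw [h3]
  ring

/-- Partial sums of the potential of the charge `b`. -/
def potential (b : EllTwo) : ℕ → EllTwo
  | 0 => 0
  | N + 1 => b + average μ (potential b N)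

lemma average_mono {f g : EllTwo} (h : ∀ x, f x ≤ g x) (x : UnitAddCircle) :
    average μ f x ≤ average μ g x :=
  hasSum_le (fun _ => mul_le_mul_of_nonneg_left (h _) ENNReal.toReal_nonneg)
    (hasSum_average_apply μ f x) (hasSum_average_apply μ g x)

lemma potential_le_succ {b : EllTwo} (hb : ∀ x, 0 ≤ b x) (N : ℕ) (x : UnitAddCircle) :
    potential μ b N x ≤ potential μ b (N + 1) x := by
  induction N generalizing x with
  | zero =>
    have h0 : average μ (0 : EllTwo) x = 0 :=
      (hasSum_average_apply μ 0 x).unique (by simp)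
    simp [potential, h0, hb x]
  | succ N ih =>
    have := average_mono μ ih x
    simp only [potential, lp.coeFn_add, Pi.add_apply] at this ⊢
    linarith

lemma potential_nonneg {b : EllTwo} (hb : ∀ x, 0 ≤ b x) (N : ℕ) (x : UnitAddCircle) :
    0 ≤ potential μ b N x := by
  induction N with
  | zero => simp [potential]
  | succ N ih => exact ih.trans (potential_le_succ μ hb N x)

/-- The partial potentials `f` increase, so pairing `f ≤ b + Pf` with `f ≥ 0` gives `‖f‖² ≤ ⟨f, b⟩ +
‖f‖² - energy/2`, and the gap yields `δ‖f‖ ≤ 2‖b‖`. Only the quadratic form of `P` is used, so `P`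
need not be self-adjoint. -/
lemma exists_potential_le (hmin : IsMinimalAction G) (hprox : IsProximalAction G)
    (hμ : Nondegenerate μ) {b : EllTwo} (hb : ∀ x, 0 ≤ b x) :
    ∃ K : ℝ, ∀ N x, potential μ b N x ≤ K := by
  obtain ⟨δ, hδ, hgap⟩ := exists_spectral_gap μ hmin hprox hμ
  refine ⟨2 * ‖b‖ / δ, fun N x => ?_⟩
  set f := potential μ b N with hf
  have h1 : ‖f‖ ^ 2 ≤ inner ℝ f (potential μ b (N + 1)) := by
    rw [← real_inner_self_eq_norm_sq]
    refine hasSum_le (fun x => ?_) (lp.hasSum_inner f f) (lp.hasSum_inner f _)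
    simp only [RCLike.inner_apply, conj_trivial]
    exact mul_le_mul_of_nonneg_right (potential_le_succ μ hb N x) (potential_nonneg μ hb N x)
  rw [potential, inner_add_right, ← hf, inner_average_self] at h1
  have h2 := real_inner_le_norm f b
  have h3 := hgap f
  have h4 : ‖f‖ ≤ 2 * ‖b‖ / δ := by
    rw [le_div_iff₀ hδ]
    rcases (norm_nonneg f).eq_or_lt with h | h
    · rw [← h, zero_mul]; positivity
    · nlinarith
  exact (le_abs_self _).trans ((lp.norm_apply_le_norm two_ne_zero f x).trans h4)

/-- A finite charge on the circle has a finite potential. -/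
lemma tsum_lt_top_of_charge (hmin : IsMinimalAction G) (hprox : IsProximalAction G)
    (hμ : Nondegenerate μ) (A : ℕ → UnitAddCircle → ℝ≥0∞) (hA1 : ∀ x, A 0 x ≤ 1)
    (hA : ∑' x, A 0 x < ∞)
    (hsucc : ∀ n x, A (n + 1) x = ∑' h : G, μ h * A n ((h : CircleHomeo)⁻¹ x))
    (x : UnitAddCircle) : ∑' n, A n x < ∞ := by
  have hfin : ∀ x, A 0 x ≠ ∞ := fun x => ((hA1 x).trans_lt ENNReal.one_lt_top).ne
  -- Since `0 ≤ A 0 ≤ 1`, summability implies square summability.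
  set b : EllTwo := ⟨fun x => (A 0 x).toReal, memEllTwo
    ((ENNReal.summable_toReal hA.ne).of_nonneg_of_le (fun _ => sq_nonneg _) fun x => by
      have h0 : 0 ≤ (A 0 x).toReal := ENNReal.toReal_nonneg
      have h1 : (A 0 x).toReal ≤ 1 := ENNReal.toReal_le_of_le_ofReal zero_le_one (by simpa using hA1 x)
      nlinarith)⟩ with hbdef
  have hb : ∀ x, 0 ≤ b x := fun x => ENNReal.toReal_nonneg
  have hbA : ∀ x, ENNReal.ofReal (b x) = A 0 x := fun x => ENNReal.ofReal_toReal (hfin x)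
  have hpot : ∀ N x, ∑ n ∈ Finset.range N, A n x = ENNReal.ofReal (potential μ b N x) := by
    intro N
    induction N with
    | zero => intro x; simp [potential]
    | succ N ih =>
      intro x
      have hnn : ∀ h : G, 0 ≤ (μ h).toReal * potential μ b N ((h : CircleHomeo)⁻¹ x) :=
        fun h => mul_nonneg ENNReal.toReal_nonneg (potential_nonneg μ hb N _)
      have hs := hasSum_average_apply μ (potential μ b N) x
      rw [potential, lp.coeFn_add, Pi.add_apply, ENNReal.ofReal_add (hb x)
        (hs.nonneg hnn), hbA, ← hs.tsum_eq,
        ENNReal.ofReal_tsum_of_nonneg hnn hs.summable, Finset.sum_range_succ', add_comm]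
      congr 1
      simp_rw [hsucc]
      rw [← Summable.tsum_finsetSum fun _ _ => ENNReal.summable]
      refine tsum_congr fun h => ?_
      rw [← Finset.mul_sum, ih, ENNReal.ofReal_mul ENNReal.toReal_nonneg,
        ENNReal.ofReal_toReal (μ.apply_ne_top h)]
  obtain ⟨K, hK⟩ := exists_potential_le μ hmin hprox hμ hb
  rw [ENNReal.tsum_eq_iSup_nat]
  refine (iSup_le fun N => ?_).trans_lt (ENNReal.ofReal_lt_top (r := K))
  rw [hpot]
  exact ENNReal.ofReal_le_ofReal (hK N x)

end Average

/-! ### The random walk -/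

section Walk

variable {G : Subgroup CircleHomeo} (μ : PMF G)

/-- The law of the increments of the random walk. -/
def incrementMeasure : Measure (ℕ → G) := Measure.infinitePi fun _ : ℕ => μ.toMeasure

instance : IsProbabilityMeasure (incrementMeasure μ) :=
  inferInstanceAs (IsProbabilityMeasure (Measure.infinitePi fun _ : ℕ => μ.toMeasure))

/-- The sequence with first term `p.1` followed by the sequence `p.2`. -/
def consSeq (p : G × (ℕ → G)) : ℕ → G
  | 0 => p.1
  | n + 1 => p.2 n

lemma measurable_consSeq : Measurable (consSeq (G := G)) := by
  refine measurable_pi_iff.2 fun n => ?_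
  cases n with
  | zero => exact measurable_fst
  | succ n => exact (measurable_pi_apply n).comp measurable_snd

/-- Prepending an independent increment preserves the i.i.d. law; this is the source of every
first-step decomposition below. -/
lemma map_consSeq :
    (μ.toMeasure.prod (incrementMeasure μ)).map consSeq = incrementMeasure μ := by
  refine Measure.eq_infinitePi _ fun s t ht => ?_
  classical
  obtain ⟨N, hN⟩ := s.exists_nat_subset_range
  -- Padding with full factors turns the index set into an initial segment, from which the factor at
  -- `0` splits off.
  set t' : ℕ → Set G := fun i => if i ∈ s then t i else univ with ht'
  have hpi : (s : Set ℕ).pi t = (Finset.range (N + 1) : Set ℕ).pi t' := by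
    ext g
    simp only [Set.mem_pi, Finset.mem_coe, ht']
    constructor
    · intro h i _
      split_ifs with his
      · exact h i his
      · trivial
    · intro h i his
      have := h i (Finset.mem_range.2 ((Finset.mem_range.1 (hN his)).trans (Nat.lt_succ_self N)))
      rwa [if_pos his] at this
  have hprod : ∏ i ∈ s, μ.toMeasure (t i) = ∏ i ∈ Finset.range (N + 1), μ.toMeasure (t' i) := by
    refine Finset.prod_subset_one_on_sdiff
      (hN.trans (Finset.range_mono (Nat.le_succ N))) (fun i hi => ?_) fun i hi => ?_
    · simp [ht', (Finset.mem_sdiff.1 hi).2]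
    · simp [ht', hi]
  have hpre : consSeq ⁻¹' ((Finset.range (N + 1) : Set ℕ).pi t') =
      t' 0 ×ˢ ((Finset.range N : Set ℕ).pi fun i => t' (i + 1)) := by
    ext p
    simp only [mem_preimage, Set.mem_pi, Finset.mem_coe, Finset.mem_range, mem_prod]
    constructor
    · intro h
      exact ⟨h 0 (Nat.succ_pos N), fun i hi => h (i + 1) (Nat.succ_lt_succ hi)⟩
    · rintro ⟨h0, h1⟩ i hi
      cases i with
      | zero => exact h0
      | succ i => exact h1 i (Nat.lt_of_succ_lt_succ hi)
  rw [hpi, hprod, Measure.map_apply measurable_consSeq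
    (MeasurableSet.pi (Finset.countable_toSet _) fun i _ => MeasurableSet.of_discrete), hpre,
    Measure.prod_prod, incrementMeasure,
    Measure.infinitePi_pi _ fun i _ => MeasurableSet.of_discrete, Finset.prod_range_succ', mul_comm]

lemma trajectory_consSeq (p : G × (ℕ → G)) (n : ℕ) :
    trajectory (consSeq p) (n + 1) = p.1 * trajectory p.2 n := by
  induction n with
  | zero => simp [trajectory, consSeq]
  | succ n ih =>
    rw [trajectory, ih, mul_assoc]
    rfl

lemma stronglyMeasurable_config_apply (x : Br G) (n : ℕ) :
    StronglyMeasurable fun w : ℕ → G => config (w n) x :=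
  ((Measurable.of_discrete (f := fun g : G => config g x)).comp
    (measurable_pi_apply n)).stronglyMeasurable

lemma measurable_limitConfig : Measurable (limitConfig : (ℕ → G) → Br G → ℝ) :=
  measurable_pi_iff.2 fun x =>
    (StronglyMeasurable.limUnder (stronglyMeasurable_config_apply x)).measurable

lemma measurable_act (hG : ∀ g ∈ G, IsPAff g) (g : G) : Measurable (act hG g) :=
  measurable_pi_iff.2 fun _ => measurable_const.add (measurable_pi_apply _)

variable [Countable G]

lemma incrementMeasure_apply {E : Set (ℕ → G)} (hE : MeasurableSet E) :
    incrementMeasure μ E = ∑' h : G, μ h * incrementMeasure μ {g | consSeq (h, g) ∈ E} := by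
  conv_lhs => rw [← map_consSeq, Measure.map_apply measurable_consSeq hE,
    Measure.prod_apply (measurable_consSeq hE), lintegral_countable']
  refine tsum_congr fun h => ?_
  rw [PMF.toMeasure_apply_singleton _ _ (MeasurableSet.of_discrete), mul_comm]
  rfl

lemma measurable_trajectory_apply (n : ℕ) : Measurable fun g : ℕ → G => trajectory g n := by
  induction n with
  | zero => exact measurable_const
  | succ n ih =>
    exact (Measurable.of_discrete (f := fun p : G × G => p.1 * p.2)).comp
      (ih.prodMk (measurable_pi_apply n))

lemma measurable_trajectory : Measurable (trajectory : (ℕ → G) → ℕ → G) :=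
  measurable_pi_iff.2 measurable_trajectory_apply

instance : IsProbabilityMeasure (pathMeasure μ) :=
  Measure.isProbabilityMeasure_map measurable_trajectory.aemeasurable

/-- The `n`-th increment of the walk changes the configuration at `x`. -/
def jumpEvent (n : ℕ) (x : UnitAddCircle) : Set (ℕ → G) :=
  {g | ((trajectory g n : G) : CircleHomeo)⁻¹ x ∈ breakpoints ((g n : CircleHomeo)⁻¹)}

lemma measurableSet_jumpEvent (n : ℕ) (x : UnitAddCircle) :
    MeasurableSet (jumpEvent (G := G) n x) :=
  ((measurable_trajectory_apply n).prodMk (measurable_pi_apply n))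
    (MeasurableSet.of_discrete (s := {p : G × G |
      (p.1 : CircleHomeo)⁻¹ x ∈ breakpoints ((p.2 : CircleHomeo)⁻¹)}))

lemma jumpEvent_zero (x : UnitAddCircle) :
    incrementMeasure μ (jumpEvent 0 x) =
      ∑' h : G, μ h * (breakpoints ((h : CircleHomeo)⁻¹)).indicator 1 x := by
  rw [incrementMeasure_apply μ (measurableSet_jumpEvent 0 x)]
  refine tsum_congr fun h => ?_
  congr 1
  have hset : {g : ℕ → G | consSeq (h, g) ∈ jumpEvent 0 x} =
      {_g | x ∈ breakpoints ((h : CircleHomeo)⁻¹)} := by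
    ext g
    simp [jumpEvent, trajectory, consSeq]
  rw [hset]
  by_cases hx : x ∈ breakpoints ((h : CircleHomeo)⁻¹) <;> simp [hx]

/-- Markov property: after a first step `h`, the walk seen from `x` is a fresh walk seen from `h⁻¹
x`. The jump probabilities are thus iterates of the Markov operator on the initial charge. -/
lemma jumpEvent_succ (n : ℕ) (x : UnitAddCircle) :
    incrementMeasure μ (jumpEvent (n + 1) x) =
      ∑' h : G, μ h * incrementMeasure μ (jumpEvent n ((h : CircleHomeo)⁻¹ x)) := by
  rw [incrementMeasure_apply μ (measurableSet_jumpEvent (n + 1) x)]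
  refine tsum_congr fun h => ?_
  congr 2
  ext g
  simp only [jumpEvent, mem_ofPred_eq, trajectory_consSeq, Subgroup.coe_mul, mul_inv_rev,
    Homeomorph.mul_apply]
  rfl

lemma tsum_jumpEvent_zero (hG : ∀ g ∈ G, IsPAff g)
    (hmoment : ∑' g : G, μ g * ((breakpoints (g : CircleHomeo)).encard : ℝ≥0∞) < ∞) :
    ∑' x, incrementMeasure μ (jumpEvent 0 x) < ∞ := by
  simp_rw [jumpEvent_zero]
  rw [ENNReal.tsum_comm]
  refine lt_of_le_of_lt (ENNReal.tsum_le_tsum fun h => ?_) hmoment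
  rw [ENNReal.tsum_mul_left, ← tsum_subtype]
  gcongr
  simp only [Pi.one_apply, ENNReal.tsum_set_one]
  exact_mod_cast encard_breakpoints_inv_le hG h.2

/-- Borel–Cantelli: the jump probabilities at `x` are summable, so almost surely only finitely many
jumps occur and the sequence is eventually constant. -/
lemma ae_exists_tendsto_config (hG : ∀ g ∈ G, IsPAff g) (hmin : IsMinimalAction G)
    (hprox : IsProximalAction G) (hμ : Nondegenerate μ)
    (hmoment : ∑' g : G, μ g * ((breakpoints (g : CircleHomeo)).encard : ℝ≥0∞) < ∞) (x : Br G) :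
    ∀ᵐ g ∂incrementMeasure μ, ∃ c, Tendsto (fun n => config (trajectory g n) x) atTop (𝓝 c) := by
  have hsum := tsum_lt_top_of_charge μ hmin hprox hμ
    (fun n x => incrementMeasure μ (jumpEvent n x)) (fun _ => prob_le_one)
    (tsum_jumpEvent_zero μ hG hmoment) (fun n x => jumpEvent_succ μ n x) x
  filter_upwards [ae_eventually_notMem hsum.ne] with g hg
  obtain ⟨N, hN⟩ := eventually_atTop.1 hg
  refine ⟨config (trajectory g N) x, tendsto_const_nhds.congr' ?_⟩
  filter_upwards [eventually_ge_atTop N] with n hn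
  induction n, hn using Nat.le_induction with
  | base => rfl
  | succ n hn ih =>
    rw [trajectory, config_mul hG, ← ih, config_eq_zero_of_notMem hG (g n)
      (invOnBr hG (trajectory g n) x) (hN n hn), add_zero]

instance : IsProbabilityMeasure (breakpointMeasure μ) :=
  Measure.isProbabilityMeasure_map measurable_limitConfig.aemeasurable

lemma ae_tendsto_limitConfig (hG : ∀ g ∈ G, IsPAff g) (hmin : IsMinimalAction G)
    (hprox : IsProximalAction G) (hμ : Nondegenerate μ)
    (hmoment : ∑' g : G, μ g * ((breakpoints (g : CircleHomeo)).encard : ℝ≥0∞) < ∞) :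
    ∀ᵐ w ∂pathMeasure μ, ∀ x : Br G,
      Tendsto (fun n => config (w n) x) atTop (𝓝 (limitConfig w x)) := by
  -- Countability lets the exceptional null sets of the individual points be merged.
  have : Countable (Br G) := (Br_countable hG).to_subtype
  rw [ae_all_iff]
  intro x
  have h : ∀ᵐ w ∂pathMeasure μ, ∃ c, Tendsto (fun n => config (w n) x) atTop (𝓝 c) :=
    (ae_map_iff measurable_trajectory.aemeasurable
      (StronglyMeasurable.measurableSet_exists_tendsto (stronglyMeasurable_config_apply x))).2
      (ae_exists_tendsto_config μ hG hmin hprox hμ hmoment x)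
  filter_upwards [h] with w hw
  exact tendsto_nhds_limUnder hw

lemma map_limitConfig_trajectory :
    (incrementMeasure μ).map (fun g => limitConfig (trajectory g)) = breakpointMeasure μ :=
  (Measure.map_map measurable_limitConfig measurable_trajectory).symm

lemma measurable_limitConfig_trajectory :
    Measurable fun g : ℕ → G => (limitConfig (trajectory g) : Br G → ℝ) :=
  measurable_limitConfig.comp measurable_trajectory

/-- The measure of the breakpoint boundary is `μ`-stationary. -/
lemma hasSum_integral_act (hG : ∀ g ∈ G, IsPAff g)
    (hconv : ∀ᵐ w ∂pathMeasure μ, ∀ x : Br G,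
      Tendsto (fun n => config (w n) x) atTop (𝓝 (limitConfig w x)))
    {F : (Br G → ℝ) → ℝ} (hF : Measurable F) (hF01 : ∀ C, F C ∈ Icc (0 : ℝ) 1) :
    HasSum (fun h : G => (∫ C, F (act hG h C) ∂breakpointMeasure μ) * (μ h).toReal)
      (∫ C, F C ∂breakpointMeasure μ) := by
  have hnorm : ∀ C, ‖F C‖ ≤ 1 := fun C => by
    rw [Real.norm_of_nonneg (hF01 C).1]; exact (hF01 C).2
  set X : (ℕ → G) → Br G → ℝ := fun g => limitConfig (trajectory g) with hX
  have hXm : Measurable X := measurable_limitConfig_trajectory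
  have hmapX : ∀ {H : (Br G → ℝ) → ℝ}, Measurable H →
      ∫ C, H C ∂breakpointMeasure μ = ∫ g, H (X g) ∂incrementMeasure μ := by
    intro H hH
    rw [← map_limitConfig_trajectory, integral_map hXm.aemeasurable
      hH.aestronglyMeasurable]
  have hconv' : ∀ᵐ g ∂incrementMeasure μ, ∀ x : Br G,
      Tendsto (fun n => config (trajectory g n) x) atTop (𝓝 (X g x)) :=
    ae_of_ae_map measurable_trajectory.aemeasurable hconv
  -- A first step `h` acts on the limit configuration by `h`. This holds only almost surely, since
  -- `limUnder` is meaningful only where the limit exists.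
  have hcons : ∀ h : G, ∀ᵐ g ∂incrementMeasure μ, X (consSeq (h, g)) = act hG h (X g) := by
    intro h
    filter_upwards [hconv'] with g hg
    funext x
    refine Tendsto.limUnder_eq ?_
    rw [← tendsto_add_atTop_iff_nat 1]
    simp_rw [trajectory_consSeq, config_mul hG]
    exact tendsto_const_nhds.add (hg (invOnBr hG h x))
  have hint : Integrable (fun p : G × (ℕ → G) => F (X (consSeq p)))
      (μ.toMeasure.prod (incrementMeasure μ)) :=
    Integrable.of_bound
      ((hF.comp (hXm.comp measurable_consSeq)).aestronglyMeasurable) 1 (ae_of_all _ fun _ => hnorm _)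
  have hterm : ∀ h : G, ∫ g, F (X (consSeq (h, g))) ∂incrementMeasure μ =
      ∫ C, F (act hG h C) ∂breakpointMeasure μ := by
    intro h
    rw [hmapX (H := fun C => F (act hG h C)) (hF.comp (measurable_act hG h))]
    refine integral_congr_ae ?_
    filter_upwards [hcons h] with g hg
    rw [hg]
  have htotal : ∫ C, F C ∂breakpointMeasure μ =
      ∑' h : G, (∫ C, F (act hG h C) ∂breakpointMeasure μ) * (μ h).toReal := by
    rw [hmapX hF]
    conv_lhs => rw [← map_consSeq]
    have hFX : Measurable fun g => F (X g) := hF.comp hXm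
    rw [integral_map measurable_consSeq.aemeasurable hFX.aestronglyMeasurable,
      integral_prod _ hint, PMF.integral_eq_tsum _ _ hint.integral_prod_left]
    refine tsum_congr fun h => ?_
    rw [hterm, smul_eq_mul, mul_comm]
  rw [htotal]
  refine Summable.hasSum ((hasSum_toReal μ).summable.of_norm_bounded fun h => ?_)
  rw [norm_mul, Real.norm_of_nonneg (ENNReal.toReal_nonneg (a := μ h))]
  refine mul_le_of_le_one_left ENNReal.toReal_nonneg ?_
  refine (norm_integral_le_of_norm_le_const (ae_of_all _ fun C => hnorm _)).trans ?_
  simp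

end Walk

/-! ### Harmonic functions from the breakpoint boundary -/

section Harmonic

variable {G : Subgroup CircleHomeo} (μ : PMF G)

/-- The indicator function of the configurations bounded by `R` at `q`. -/
def boundedAt (q : Br G) (R : ℝ) : (Br G → ℝ) → ℝ := {C | |C q| ≤ R}.indicator 1

lemma boundedAt_mem_Icc (q : Br G) (R : ℝ) (C : Br G → ℝ) : boundedAt q R C ∈ Icc (0 : ℝ) 1 := by
  by_cases h : |C q| ≤ R <;> simp [boundedAt, indicator, h]

lemma measurable_boundedAt (q : Br G) (R : ℝ) : Measurable (boundedAt q R) :=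
  measurable_one.indicator (measurableSet_le (measurable_pi_apply q).abs measurable_const)

lemma act_pow_apply_of_fixed (hG : ∀ g ∈ G, IsPAff g) {a : G} {q : Br G}
    (hq : (a : CircleHomeo) q = q) (k : ℕ) (C : Br G → ℝ) :
    act hG (a ^ k) C q = k * config a q + C q := by
  have hfix : ∀ k : ℕ, ((a ^ k : G) : CircleHomeo) q = q := by
    intro k
    induction k with
    | zero => rfl
    | succ k ih => rw [pow_succ, Subgroup.coe_mul, Homeomorph.mul_apply, hq, ih]
  have hinv : invOnBr hG (a ^ k) q = q := by
    apply Subtype.ext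
    have := inv_apply_apply ((a ^ k : G) : CircleHomeo) q
    rw [hfix k] at this
    exact this
  change config (a ^ k) q + C (invOnBr hG (a ^ k) q) = _
  rw [hinv, config_pow_of_fixed hG a q hq]

variable [Countable G]

lemma tendsto_integral_boundedAt (q : Br G) :
    Tendsto (fun R : ℕ => ∫ C, boundedAt q R C ∂breakpointMeasure μ) atTop (𝓝 1) := by
  have h := tendsto_integral_of_dominated_convergence (μ := breakpointMeasure μ)
    (F := fun R : ℕ => boundedAt q (R : ℝ)) (f := fun _ => 1) (fun _ => 1)
    (fun R => (measurable_boundedAt q R).aestronglyMeasurable) (integrable_const _)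
    (fun R => ae_of_all _ fun C => by
      rw [Real.norm_of_nonneg (boundedAt_mem_Icc q R C).1]; exact (boundedAt_mem_Icc q R C).2)
    (ae_of_all _ fun C => by
      refine tendsto_const_nhds.congr' ?_
      filter_upwards [eventually_ge_atTop ⌈|C q|⌉₊] with R hR
      have : |C q| ≤ R := Nat.ceil_le.1 hR
      simp [boundedAt, this])
  simpa using h

/-- On the coordinate `q`, the power `a ^ k` is translation by `k * config a q`, which eventually
carries every value out of the window `[-R, R]`; dominated convergence does the rest. -/
lemma tendsto_integral_boundedAt_act (hG : ∀ g ∈ G, IsPAff g) {a : G} {q : Br G}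
    (hq : (a : CircleHomeo) q = q) (hne : config a q ≠ 0) (R : ℝ) :
    Tendsto (fun k : ℕ => ∫ C, boundedAt q R (act hG (a ^ k) C) ∂breakpointMeasure μ)
      atTop (𝓝 0) := by
  have h := tendsto_integral_of_dominated_convergence (μ := breakpointMeasure μ)
    (F := fun k : ℕ => fun C => boundedAt q R (act hG (a ^ k) C)) (f := fun _ => 0) (fun _ => 1)
    (fun k => ((measurable_boundedAt q R).comp (measurable_act hG _)).aestronglyMeasurable)
    (integrable_const _)
    (fun k => ae_of_all _ fun C => by
      rw [Real.norm_of_nonneg (boundedAt_mem_Icc q R _).1]; exact (boundedAt_mem_Icc q R _).2)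
    (ae_of_all _ fun C => by
      refine tendsto_const_nhds.congr' ?_
      have hc : 0 < |config a q| := abs_pos.2 hne
      filter_upwards [eventually_gt_atTop ⌈(R + |C q|) / |config a q|⌉₊] with k hk
      have h1 : (R + |C q|) / |config a q| < k := Nat.lt_of_ceil_lt hk
      rw [div_lt_iff₀ hc] at h1
      have h2 : |(k : ℝ) * config a q| ≤ |k * config a q + C q| + |C q| := by
        have := abs_sub (k * config a q + C q) (C q)
        rwa [add_sub_cancel_right] at this
      rw [abs_mul, Nat.abs_cast] at h2
      have h3 : ¬ |act hG (a ^ k) C q| ≤ R := by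
        rw [act_pow_apply_of_fixed hG hq]
        linarith
      simp [boundedAt, indicator, h3])
  simpa using h

lemma exists_harmonic_small (hG : ∀ g ∈ G, IsPAff g) (hprox : IsProximalAction G)
    (hnonfree : IsTopologicallyNonfree G) {ε : ℝ} (hε : 0 < ε) :
    ∃ (F : (Br G → ℝ) → ℝ) (a : G), Measurable F ∧ (∀ C, F C ∈ Icc (0 : ℝ) 1) ∧
      1 / 2 < ∫ C, F (act hG 1 C) ∂breakpointMeasure μ ∧
      Metric.diam (supp (a : CircleHomeo)) < ε ∧
      ∫ C, F (act hG a C) ∂breakpointMeasure μ < ε := by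
  obtain ⟨a, q, hdiam, hq, hne⟩ := exists_config_ne_zero hG hprox hnonfree hε
  -- The order of choices matters: `R` is fixed by the value at the identity, and only then is `k`
  -- taken large depending on `R`.
  obtain ⟨R, hR⟩ := ((tendsto_integral_boundedAt μ q).eventually
    (lt_mem_nhds (by norm_num : (1 / 2 : ℝ) < 1))).exists
  obtain ⟨k, hk⟩ := ((tendsto_integral_boundedAt_act μ hG hq hne R).eventually
    (gt_mem_nhds hε)).exists
  refine ⟨boundedAt q R, a ^ k, measurable_boundedAt q R, boundedAt_mem_Icc q R, ?_, ?_, hk⟩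
  · simpa only [act_one] using hR
  · rw [Subgroup.coe_pow]
    exact (diam_supp_pow_le _ k).trans_lt hdiam

lemma integral_mem_Icc {F : (Br G → ℝ) → ℝ} (hF : Measurable F)
    (hF01 : ∀ C, F C ∈ Icc (0 : ℝ) 1) :
    ∫ C, F C ∂breakpointMeasure μ ∈ Icc (0 : ℝ) 1 := by
  refine ⟨integral_nonneg fun C => (hF01 C).1, ?_⟩
  have hint : Integrable F (breakpointMeasure μ) :=
    Integrable.of_bound hF.aestronglyMeasurable 1 (ae_of_all _ fun C => by
      rw [Real.norm_of_nonneg (hF01 C).1]; exact (hF01 C).2)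
  simpa using integral_mono hint (integrable_const 1) fun C => (hF01 C).2

end Harmonic

end BreakpointBoundary

end

open BreakpointBoundary in
theorem lemma7p5 (G : Subgroup CircleHomeo) (hcount : Countable G)
    (hG : ∀ g ∈ G, IsPAff g)
    (hmin : IsMinimalAction G) (hprox : IsProximalAction G) (hnonfree : IsTopologicallyNonfree G)
    (μ : PMF G) (hμ : Nondegenerate μ)
    (hmoment : ∑' g : G, μ g * ((breakpoints (g : CircleHomeo)).encard : ℝ≥0∞) < ∞) :
    -- the configurations converge along almost every trajectory, so `ν̃` is well defined
    (∀ᵐ w ∂(pathMeasure μ), ∀ x : Br G,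
      Tendsto (fun n => config (w n) x) atTop (𝓝 (limitConfig w x))) ∧
    IsProbabilityMeasure (breakpointMeasure μ) ∧
    ∃ (f : ℕ → G → ℝ) (a : ℕ → G),
      (∀ n g, f n g ∈ Icc (0 : ℝ) 1) ∧
      (∀ n, IsHarmonic μ (f n)) ∧
      -- `f n` is the Poisson transform of a function on the breakpoint boundary
      (∀ n, ∃ F : (Br G → ℝ) → ℝ, Measurable F ∧ (∀ C, F C ∈ Icc (0 : ℝ) 1) ∧
        ∀ g, f n g = ∫ C, F (act hG g C) ∂(breakpointMeasure μ)) ∧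
      (∀ n, 1 / 2 < f n 1) ∧
      Tendsto (fun n => Metric.diam (supp (a n : CircleHomeo))) atTop (𝓝 0) ∧
      Tendsto (fun n => f n (a n)) atTop (𝓝 0) := by
  have hconv := ae_tendsto_limitConfig μ hG hmin hprox hμ hmoment
  refine ⟨hconv, inferInstance, ?_⟩
  choose F a hF hF01 hhalf hdiam hsmall using fun n : ℕ =>
    exists_harmonic_small μ hG hprox hnonfree (Nat.one_div_pos_of_nat (α := ℝ) (n := n))
  have hFact : ∀ n g, Measurable fun C => F n (act hG g C) :=
    fun n g => (hF n).comp (measurable_act hG g)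
  have hmem : ∀ n g, ∫ C, F n (act hG g C) ∂breakpointMeasure μ ∈ Icc (0 : ℝ) 1 :=
    fun n g => integral_mem_Icc μ (hFact n g) fun C => hF01 n _
  refine ⟨fun n g => ∫ C, F n (act hG g C) ∂breakpointMeasure μ, a, hmem, fun n g => ?_,
    fun n => ⟨F n, hF n, hF01 n, fun g => rfl⟩, hhalf, ?_, ?_⟩
  · have := hasSum_integral_act μ hG hconv (hFact n g) fun C => hF01 n _
    simpa only [act_mul] using this
  · exact squeeze_zero (fun n => Metric.diam_nonneg) (fun n => (hdiam n).le)
      tendsto_one_div_add_atTop_nhds_zero_nat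
  · exact squeeze_zero (fun n => (hmem n _).1) (fun n => (hsmall n).le)
      tendsto_one_div_add_atTop_nhds_zero_nat
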